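/- **Setting.** There are $n\ge 1$ processors $p_0,\dots,p_{n-1}$; $t$ is the largest integer less than $n/3$, and $f\le t$ processors are Byzantine (behave arbitrarily), the others are correct. Signatures and threshold signatures are unforgeable. Messages are not lost, arrive strictly after they are sent, and only finitely many are sent in bounded time; a message sent at time $s$ between correct processors arrives by time $\max\{GST,s\}+\delta$, where $0<\delta\le\Delta$; $\Delta$ is known, while $GST\ge 0$, $\delta$ and $f$ are not. Fix $k\ge 3$ and a real $x\ge 2$, and let $\Gamma=x\Delta$. The leader of view $v$ is $\mathtt{lead}(v)=p_{\lfloor v/k\rfloor \bmod n}$; $v$ is *initial* if $k\mid v$. *Partial initial clock synchronisation:* a correct processor begins the execution when its clock reads $0$; at time $0$ the clocks of correct processors are $\le 0$, and for each correct $p$ at least $t+1$ correct processors ($p$ included) have clocks at most $\Gamma$ behind that of $p$. Clocks of correct processors all run at speed one, except for the forwarding described next. **The protocol Fever.** The clock-time of view $v$ is $c_v=\Gamma v$. A processor enters an initial view $v$ when its clock equals $c_v$, and then sends a signed $\mathtt{view}\ v$ message to $\mathtt{lead}(v)$. It enters a non-initial view $v$ when it receives a quorum certificate (QC) for view $v-1$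 while in no view or in a view $<v$. When $\mathtt{lead}(v)$, $v$ initial, has first received $\mathtt{view}\ v$ messages from $t+1$ distinct processors, it combines them into a view certificate (VC) for view $v$ and sends it to all processors. A processor that receives a VC for view $v$ or a QC for view $v-1$ while its clock is below $c_v$ instantaneously forwards its clock to $c_v$. **The underlying protocol** is any protocol with these properties. A QC for view $v$ combines signatures of $n-t$ processors, and correct processors sign for view $v$ only while in view $v$; if $\mathtt{lead}(v)$ is correct, it is the one who produces the QC for view $v$, and it sends it to all processors. If $\mathtt{lead}(v)$ is correct, $s\ge GST$, and at least $n-t$ correct processors are in view $v$ from time $s$ until either they receive a QC for view $v$ or until $s+x\delta$, then all correct processors receive a QC for view $v$ by time $s+x\delta$. Correct processors (combined) send at most $Bn$ messages of the underlying protocol per view, for a constant $B$, and they send the messages of a view while they are in that view, except that a leader may send out the QC that it produces at any time. **Theorem.** Let $t^{*}$ be the least time $>GST$ at which some correct $\mathtt{lead}(v)$ produces a QC for view $v$ ($\infty$ if there is none). There is a constant $C$, depending only on $k$, $x$ and $B$, such that every such execution satisfies the following. 1. *(View monotonicity.)* If a correct processor is in view $v$ at time $s$ and in view $v'$ at time $s'\ge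 s$, then $v'\ge v$. 2. *(Eventual synchronisation.)* There are a view $v$ with correct leader, which no correct processor has reached by $GST$, and a time $s\ge GST$ such that each correct processor is in view $v$ from time $s$ until either it receives a QC for view $v$ or until $s+\Gamma$. 3. *(Word complexity.)* The number of words (messages) sent by correct processors, combined, strictly between $GST+2\delta$ and $t^{*}$ is at most $C(fn+n)$. (In particular, if $2\delta\le\Delta$, this bounds the number of words sent strictly between $GST+\Delta$ and $t^{*}$.) 4. *(Latency.)* If at least one correct processor, and in the case $f=0$ at least $t+1$ correct processors, have begun the execution by $GST$, then $t^{*}-GST\le C(\Delta f+\delta)$. -/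

import Mathlib

namespace Fever

/-- The resilience `t`: the largest integer `< n / 3` (for `n ≥ 1`). -/
def resilience (n : ℕ) : ℕ := (n - 1) / 3

theorem resilience_isGreatest (n : ℕ) (hn : 0 < n) :
    IsGreatest {m : ℕ | (m : ℚ) < (n : ℚ) / 3} (resilience n) := by
  have key : ∀ m : ℕ, (m : ℚ) < (n : ℚ) / 3 ↔ 3 * m < n := by
    intro m
    rw [lt_div_iff₀ (by norm_num)]
    constructor
    · intro h
      have h' : ((m * 3 : ℕ) : ℚ) < (n : ℚ) := by push_cast; exact h
      have := Nat.cast_lt.mp h'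
      omega
    · intro h
      have h' : ((3 * m : ℕ) : ℚ) < (n : ℚ) := Nat.cast_lt.mpr h
      push_cast at h'
      linarith
  refine ⟨?_, ?_⟩
  · rw [Set.mem_ofPred_eq, key, resilience]
    omega
  · intro m hm
    rw [Set.mem_ofPred_eq, key] at hm
    rw [resilience]
    omega

/-- The leader of view `v` is processor `⌊v / k⌋ mod n`. -/
def lead (n k : ℕ) [NeZero n] (v : ℕ) : Fin n := Fin.ofNat n (v / k)

/-- A view is initial if it is divisible by `k`. -/
def Initial (k v : ℕ) : Prop := v % k = 0

/-- The clock-time `c_v = Γ v` of view `v`. -/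
def clockTime (Γ : ℝ) (v : ℕ) : ℝ := Γ * v

/-- Message contents. Each message is one word.
* `view v`: the signed message `view v`;
* `vc v`: a view certificate for view `v`;
* `under w q`: a message of the underlying protocol that belongs to the instructions of view `w`;
  if `q = some v`, the message carries a quorum certificate for view `v`. -/
inductive Content : Type
  | view (v : ℕ)
  | vc (v : ℕ)
  | under (w : ℕ) (q : Option ℕ)

/-- The record of an execution with processors `Fin n`: which processors are Byzantine (corrupted
at any point), the global stabilisation time, the clock and the present view of each processor at
each time (`⊥`: in no view yet), and all messages, with their times of sending and of arrival.
The values at time `τ` are those after everything that happens at time `τ`.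
Time starts at `0`. -/
structure Execution (n : ℕ) where
  byz : Finset (Fin n)
  gst : ℝ
  clock : Fin n → ℝ → ℝ
  view : Fin n → ℝ → WithBot ℕ
  Msg : Type
  src : Msg → Fin n
  dst : Msg → Fin n
  content : Msg → Content
  sent : Msg → ℝ
  recv : Msg → ℝ

namespace Execution

variable {n : ℕ} (E : Execution n)

/-- A processor is correct if it is not Byzantine. -/
def Correct (p : Fin n) : Prop := p ∉ E.byz

/-- The message `m` carries a QC for view `v`. -/
def CarriesQC (m : E.Msg) (v : ℕ) : Prop := ∃ w, E.content m = Content.under w (some v)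

/-- At time `τ`, processor `p` receives a QC for view `v`. -/
def RecvQC (p : Fin n) (v : ℕ) (τ : ℝ) : Prop :=
  ∃ m, E.dst m = p ∧ E.recv m = τ ∧ E.CarriesQC m v

/-- By time `τ`, processor `p` has received a QC for view `v`. -/
def HasQC (p : Fin n) (v : ℕ) (τ : ℝ) : Prop := ∃ s ≤ τ, E.RecvQC p v s

/-- At time `τ`, processor `p` receives a VC for view `v`. -/
def RecvVC (p : Fin n) (v : ℕ) (τ : ℝ) : Prop :=
  ∃ m, E.dst m = p ∧ E.recv m = τ ∧ E.content m = Content.vc v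

/-- At time `τ`, processor `p` receives a certificate that makes it forward its clock to the
clock-time of view `v` if its clock is behind: a VC for view `v` or a QC for view `v - 1`. -/
def RecvCert (p : Fin n) (v : ℕ) (τ : ℝ) : Prop :=
  E.RecvVC p v τ ∨ ∃ u, v = u + 1 ∧ E.RecvQC p u τ

/-- The processors whose `view v` messages have been received by `p` by time `τ`. -/
def viewSenders (p : Fin n) (v : ℕ) (τ : ℝ) : Set (Fin n) :=
  {q | ∃ m, E.src m = q ∧ E.dst m = p ∧ E.content m = Content.view v ∧ E.recv m ≤ τ}

/-- `p` sends a message with content `c` to `d` at time `τ`. -/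
def Sends (p d : Fin n) (c : Content) (τ : ℝ) : Prop :=
  ∃ m, E.src m = p ∧ E.dst m = d ∧ E.content m = c ∧ E.sent m = τ

/-- `lead(v)` produces a QC for view `v` at time `τ`: this is when it first sends one. -/
def Produces [NeZero n] (k v : ℕ) (τ : ℝ) : Prop :=
  IsLeast {s | ∃ m, E.src m = lead n k v ∧ E.CarriesQC m v ∧ E.sent m = s} τ

/-- Partial synchrony with point-to-point authenticated channels, and delays of at most `δ`
after GST: a message between correct processors that is sent at time `τ` arrives by
`max GST τ + δ`. Messages arrive strictly after they are sent, no message is lost, and only finitely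
many messages are sent in bounded time. -/
structure PartialSynchrony (δ : ℝ) : Prop where
  gst_nonneg : 0 ≤ E.gst
  sent_nonneg : ∀ m, 0 ≤ E.sent m
  sent_lt_recv : ∀ m, E.sent m < E.recv m
  delay : ∀ m, E.Correct (E.src m) → E.Correct (E.dst m) → E.recv m ≤ max E.gst (E.sent m) + δ
  finite_sent : ∀ T : ℝ, {m | E.sent m ≤ T}.Finite

/-- Partial initial clock synchronisation with bound `Γ`. Every correct processor begins the
protocol execution when its clock reads `0`; the execution starts at time `0`, when clocks of
processors that still have to begin are negative. For each correct `p`, at least `t + 1` correct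
processors (`p` included) have clocks that are at most `Γ` behind the clock of `p`. -/
structure PartialInitialClockSync (Γ : ℝ) : Prop where
  clock_zero_nonpos : ∀ p, E.Correct p → E.clock p 0 ≤ 0
  clock_zero_sync : ∀ p, E.Correct p →
    resilience n + 1 ≤ {q | E.Correct q ∧ E.clock p 0 - Γ ≤ E.clock q 0}.ncard

/-- The correct processors follow the instructions of Fever, and threshold signatures cannot be
forged. -/
structure FollowsFever [NeZero n] (k : ℕ) (Γ : ℝ) : Prop where
  /-- Clocks run at speed one, and are forwarded instantaneously, by certificates only. -/
  clock_step : ∀ p, E.Correct p → ∀ a b : ℝ, 0 ≤ a → a < b →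
    (∀ s, a < s → s < b → ∀ v, ¬ E.RecvCert p v s) →
    IsGreatest ({E.clock p a + (b - a)} ∪ {c | ∃ v, E.RecvCert p v b ∧ c = clockTime Γ v})
      (E.clock p b)
  /-- A processor whose clock is still negative at the start is in no view. -/
  view_start : ∀ p, E.Correct p → E.clock p 0 < 0 → E.view p 0 = ⊥
  /-- An initial view is entered when the clock equals its clock-time. -/
  view_initial : ∀ p, E.Correct p → ∀ v, Initial k v → ∀ τ : ℝ, 0 ≤ τ →
    E.clock p τ = clockTime Γ v → E.view p τ = (v : WithBot ℕ)
  /-- A non-initial view `u + 1` is entered on receipt of a QC for view `u`, if the present view is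
  lower. There is no other reason for a change of view. -/
  view_step : ∀ p, E.Correct p → ∀ a b : ℝ, 0 ≤ a → a < b →
    (∀ s, a < s → s < b →
      (∀ v, Initial k v → E.clock p s ≠ clockTime Γ v) ∧ (∀ u, ¬ E.RecvQC p u s)) →
    (∀ v, Initial k v → E.clock p b ≠ clockTime Γ v) →
    IsGreatest ({E.view p a} ∪
        {w | ∃ u : ℕ, ¬ Initial k (u + 1) ∧ E.RecvQC p u b ∧ w = ((u + 1 : ℕ) : WithBot ℕ)})
      (E.view p b)
  /-- On entering an initial view `v` (and at no other time) a processor sends `view v`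
  to `lead(v)`. -/
  view_message : ∀ p, E.Correct p → ∀ (d : Fin n) (v : ℕ) (τ : ℝ),
    E.Sends p d (Content.view v) τ ↔
      0 ≤ τ ∧ Initial k v ∧ d = lead n k v ∧ E.clock p τ = clockTime Γ v
  /-- A VC for an initial view `v` is sent by `lead(v)`, to all processors, when it has first
  received `view v` messages from `t + 1` processors. -/
  vc_message : ∀ p, E.Correct p → ∀ (d : Fin n) (v : ℕ) (τ : ℝ),
    E.Sends p d (Content.vc v) τ ↔
      Initial k v ∧ p = lead n k v ∧
        IsLeast {s : ℝ | resilience n + 1 ≤ (E.viewSenders p v s).ncard} τ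
  /-- Each of these messages is sent once. -/
  once : ∀ m m' v, E.Correct (E.src m) → (E.content m = Content.view v ∨ E.content m = Content.vc v) →
    E.src m = E.src m' → E.dst m = E.dst m' → E.content m = E.content m' →
    E.sent m = E.sent m' → m = m'
  /-- A VC for view `v`, whoever sends it, combines the signatures of `t + 1` processors, and
  those of correct processors come from their `view v` messages. -/
  vc_sound : ∀ m v, E.content m = Content.vc v →
    ∃ S : Finset (Fin n), resilience n + 1 ≤ S.card ∧ ∀ q ∈ S, E.Correct q →
      ∃ m', E.src m' = q ∧ E.content m' = Content.view v ∧ E.sent m' ≤ E.sent m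

/-- `p` is in view `v` from time `a` until either it receives a QC for view `v` or until time `b`. -/
def InViewUntilQC (p : Fin n) (v : ℕ) (a b : ℝ) : Prop :=
  ∀ τ, a ≤ τ → τ < b → E.view p τ = (v : WithBot ℕ) ∨ E.HasQC p v τ

/-- The properties of the underlying protocol: `x δ` is the time that suffices for the completion of
a view, and `B n` bounds the number of messages of correct processors per view. -/
structure UnderlyingProtocol [NeZero n] (k : ℕ) (x δ : ℝ) (B : ℕ) : Prop where
  /-- A QC for view `v`, whoever sends it, combines signatures of `n - t` processors; a correct
  processor only signs while it is in view `v`. -/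
  qc_sound : ∀ m v, E.CarriesQC m v →
    ∃ S : Finset (Fin n), n - resilience n ≤ S.card ∧ ∀ q ∈ S, E.Correct q →
      ∃ s, 0 ≤ s ∧ s ≤ E.sent m ∧ E.view q s = (v : WithBot ℕ)
  /-- The signatures go to the leader: if `lead(v)` is correct, there is no QC for view `v` before
  `lead(v)` has produced one. -/
  qc_leader : ∀ m v, E.Correct (lead n k v) → E.CarriesQC m v →
    ∃ m', E.src m' = lead n k v ∧ E.CarriesQC m' v ∧ E.sent m' ≤ E.sent m
  /-- A correct leader that produces a QC sends it to all processors. -/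
  qc_broadcast : ∀ v τ, E.Correct (lead n k v) → E.Produces k v τ →
    ∀ d, ∃ m, E.src m = lead n k v ∧ E.dst m = d ∧ E.CarriesQC m v ∧ E.sent m = τ
  /-- Sufficient time for view completion. -/
  sufficient_time : ∀ (v : ℕ) (a : ℝ), E.Correct (lead n k v) → E.gst ≤ a →
    (∃ S : Finset (Fin n), n - resilience n ≤ S.card ∧
      ∀ p ∈ S, E.Correct p ∧ E.InViewUntilQC p v a (a + x * δ)) →
    ∀ p, E.Correct p → E.HasQC p v (a + x * δ)
  /-- A correct processor sends messages of view `w` while in view `w`, except that a leader may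
  send out the QC that it produces for its view `w` at any time. -/
  in_view : ∀ m w q, E.Correct (E.src m) → E.content m = Content.under w q →
    E.view (E.src m) (E.sent m) = (w : WithBot ℕ) ∨
      (q = some w ∧ E.src m = lead n k w ∧ E.Produces k w (E.sent m))
  /-- Correct processors (combined) send `O(n)` messages per view. -/
  linear : ∀ w, {m | E.Correct (E.src m) ∧ ∃ q, E.content m = Content.under w q}.encard ≤
    ((B * n : ℕ) : ℕ∞)

/-- The executions of Fever, run with an underlying protocol, that the theorem is about: at most
`t` Byzantine processors, delays of at most `δ ≤ Δ` after GST, and partial initial clock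
synchronisation with `Γ = x Δ`. -/
structure IsFeverExecution [NeZero n] (k : ℕ) (x : ℝ) (B : ℕ) (Δ δ : ℝ) : Prop where
  delta_pos : 0 < δ
  delta_le : δ ≤ Δ
  byz_card : E.byz.card ≤ resilience n
  network : E.PartialSynchrony δ
  clocks : E.PartialInitialClockSync (x * Δ)
  fever : E.FollowsFever k (x * Δ)
  underlying : E.UnderlyingProtocol k x δ B

/-- View synchronisation, condition (1): views of correct processors never decrease. -/
def ViewMonotone : Prop :=
  ∀ p, E.Correct p → ∀ τ τ' : ℝ, 0 ≤ τ → τ ≤ τ' → E.view p τ ≤ E.view p τ'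

/-- View synchronisation, condition (2): for some view `v` with correct leader and some time
`a ≥ GST`, each correct processor is in view `v` from time `a` until either it receives a QC for
view `v` or until `a + Γ`. The view `v` is moreover one that no correct processor has
reached by GST. -/
def EventuallySynchronised [NeZero n] (k : ℕ) (Γ : ℝ) : Prop :=
  ∃ (v : ℕ) (a : ℝ), E.Correct (lead n k v) ∧ E.gst ≤ a ∧
    (∀ p, E.Correct p → E.view p E.gst < (v : WithBot ℕ)) ∧
    ∀ p, E.Correct p → E.InViewUntilQC p v a (a + Γ)

/-- The time `t*`: the least time `> GST` at which some correct `lead(v)` produces a QC for view `v`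
(`⊤` if there is no such time). -/
noncomputable def firstQC [NeZero n] (k : ℕ) : EReal :=
  sInf {τ : EReal | ∃ (r : ℝ) (v : ℕ),
    τ = (r : EReal) ∧ E.gst < r ∧ E.Correct (lead n k v) ∧ E.Produces k v r}

/-- The latency `t* - GST`. -/
noncomputable def latency [NeZero n] (k : ℕ) : EReal := E.firstQC k - (E.gst : EReal)

/-- The number of words sent by correct processors (combined) between time `a` and `t*`. -/
noncomputable def wordsFrom [NeZero n] (k : ℕ) (a : ℝ) : ℕ∞ :=
  {m | E.Correct (E.src m) ∧ a < E.sent m ∧ (E.sent m : EReal) < E.firstQC k}.encard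

/-- The number of correct processors that have begun the protocol execution by GST. -/
noncomputable def begunByGST : ℕ := {p | E.Correct p ∧ 0 ≤ E.clock p E.gst}.ncard

end Execution

end Fever

/-!
The argument compares how fast a block of `k` views with a common leader can pass with how long its
leader needs. At all times `t + 1` correct clocks are at most `Γ` behind any given correct clock.
Hence, before a correct clock is `Γ` past an initial view `v`, `t + 1` correct processors have
entered `v` by themselves, and if `lead(v)` is correct, then after GST the resulting VC brings
everybody into the block of `v` within `2 δ`. Without a QC for `v` or later views, on the other
hand, every clock past `v` goes back to an entry into `v` and has run at speed one since. As
`Γ + (2 + x) δ ≤ k Γ`, a block with correct leader that starts after GST therefore yields a QC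
before any correct processor leaves it. One of any `f + 1` consecutive blocks has a correct leader,
so `t*` comes before the end of the `(f + 1)`-st block that is fresh at GST, and laggards are at
most `f + O(1)` blocks behind from `GST + 2 δ` on.

If `f = 0`, then as long as no QC is produced after GST, everybody holds every QC by `GST + δ`.
Processors that are in a block together then complete its views and time out of it, so that `t + 1`
of them enter the next block within `(2 + x) δ ≤ (k - 1) Γ`. But `k + 1` steps of this kind take
less than the time `k² Γ` in which clocks that run at speed one pass `k` blocks.
-/

namespace Fever

/-- A set of times of which only finitely many lie below any bound. The times of the events of an
execution form such sets, which replaces induction over discrete time. -/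
def FiniteBelow (F : Set ℝ) : Prop := ∀ T, (F ∩ Set.Iic T).Finite

namespace FiniteBelow

variable {F G : Set ℝ}

theorem mono (hF : FiniteBelow F) (hGF : G ⊆ F) : FiniteBelow G := fun T =>
  (hF T).subset (Set.inter_subset_inter_left _ hGF)

theorem union (hF : FiniteBelow F) (hG : FiniteBelow G) : FiniteBelow (F ∪ G) := fun T => by
  rw [Set.union_inter_distrib_right]
  exact (hF T).union (hG T)

theorem iUnion {ι : Type*} [Finite ι] {F : ι → Set ℝ} (hF : ∀ i, FiniteBelow (F i)) :
    FiniteBelow (⋃ i, F i) := fun T => by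
  rw [Set.iUnion_inter]
  exact Set.finite_iUnion fun i => hF i T

theorem exists_isLeast (hF : FiniteBelow F) (hne : F.Nonempty) : ∃ a, IsLeast F a := by
  obtain ⟨b, hb⟩ := hne
  obtain ⟨a, ⟨haF, hab⟩, hmin⟩ := Set.exists_min_image _ id (hF b)
    ⟨b, hb, Set.self_mem_Iic⟩
  refine ⟨a, haF, fun s hs => ?_⟩
  rcases le_total s b with hsb | hbs
  exacts [hmin s ⟨hs, hsb⟩, le_trans hab hbs]

theorem strong_induction (hF : FiniteBelow F) {P : ℝ → Prop}
    (step : ∀ τ, (∀ s ∈ F, s < τ → P s) → P τ) (τ : ℝ) : P τ := by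
  induction hN : (F ∩ Set.Iio τ).ncard using Nat.strong_induction_on generalizing τ with
  | _ N ih =>
    refine step τ fun s hs hsτ => ih _ ?_ s rfl
    rw [← hN]
    exact Set.ncard_lt_ncard
      ⟨fun r hr => ⟨hr.1, hr.2.trans hsτ⟩, fun hsub => lt_irrefl s (hsub ⟨hs, hsτ⟩).2⟩
      ((hF τ).subset fun r hr => ⟨hr.1, Set.mem_Iic.2 (le_of_lt hr.2)⟩)

@[elab_as_elim]
theorem step_induction (hF : FiniteBelow F) {P : ∀ τ : ℝ, 0 ≤ τ → Prop} (zero : P 0 le_rfl)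
    (step : ∀ a b (ha : 0 ≤ a) (hab : a < b), (∀ s, a < s → s < b → s ∉ F) → P a ha →
      P b (ha.trans hab.le)) (τ : ℝ) (hτ : 0 ≤ τ) : P τ hτ := by
  induction τ using hF.strong_induction with
  | step τ ih =>
  rcases hτ.eq_or_lt with rfl | hpos
  · exact zero
  rcases (F ∩ Set.Ioo 0 τ).eq_empty_or_nonempty with hempty | hne
  · exact step 0 τ le_rfl hpos (fun s h0s hsτ hs => hempty.subset ⟨hs, h0s, hsτ⟩) zero
  · obtain ⟨a, ⟨haF, h0a, haτ⟩, hmax⟩ := Set.exists_max_image _ id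
      ((hF τ).subset fun s hs => ⟨hs.1, hs.2.2.le⟩) hne
    exact step a τ h0a.le haτ
      (fun s has hsτ hs => (hmax s ⟨hs, h0a.trans has, hsτ⟩).not_gt has) (ih a haF haτ h0a.le)

end FiniteBelow

section Views

variable {n k v w : ℕ} {Γ : ℝ}

theorem three_mul_resilience_lt (n : ℕ) [NeZero n] : 3 * resilience n < n := by
  have := NeZero.pos n
  rw [resilience]
  omega

theorem initial_mul (k j : ℕ) : Initial k (k * j) := Nat.mul_mod_right k j

theorem not_initial_of_lt (hv : Initial k v) (hvw : v < w) (hwk : w < v + k) : ¬ Initial k w := by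
  intro hw
  obtain ⟨d, rfl⟩ := Nat.exists_eq_add_of_lt hvw
  have hdvd : k ∣ d + 1 :=
    (Nat.dvd_add_right (Nat.dvd_of_mod_eq_zero hv)).1 (Nat.dvd_of_mod_eq_zero hw)
  exact absurd (Nat.le_of_dvd d.succ_pos hdvd) (by omega)

theorem lead_eq_of_initial [NeZero n] (hv : Initial k v) (hvw : v ≤ w) (hwk : w < v + k) :
    lead n k w = lead n k v := by
  obtain ⟨a, rfl⟩ := Nat.dvd_of_mod_eq_zero hv
  obtain ⟨d, rfl⟩ := Nat.exists_eq_add_of_le hvw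
  rw [lead, lead, Nat.mul_add_div (by omega), Nat.mul_div_cancel_left a (by omega),
    Nat.div_eq_of_lt (by omega : d < k), Nat.add_zero]

theorem clockTime_le_clockTime (hΓ : 0 < Γ) : clockTime Γ v ≤ clockTime Γ w ↔ v ≤ w := by
  rw [clockTime, clockTime, mul_le_mul_iff_right₀ hΓ, Nat.cast_le]

theorem clockTime_nonneg (hΓ : 0 < Γ) (v : ℕ) : 0 ≤ clockTime Γ v :=
  mul_nonneg hΓ.le v.cast_nonneg

theorem clockTime_zero (Γ : ℝ) : clockTime Γ 0 = 0 := by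
  rw [clockTime, Nat.cast_zero, mul_zero]

theorem clockTime_add (Γ : ℝ) (v w : ℕ) : clockTime Γ (v + w) = clockTime Γ v + w * Γ := by
  simp only [clockTime, Nat.cast_add]
  ring

theorem clockTime_succ (Γ : ℝ) (v : ℕ) : clockTime Γ (v + 1) = clockTime Γ v + Γ := by
  rw [clockTime_add, Nat.cast_one, one_mul]

end Views

/-- The view that a message belongs to. -/
def Content.index : Content → ℕ
  | .view v => v
  | .vc v => v
  | .under w _ => w

namespace Execution

variable {n : ℕ} {E : Execution n} {k B u v w : ℕ} {Γ x Δ δ σ τ : ℝ} {p q : Fin n} {m : E.Msg}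

/-- At least `t + 1` correct processors satisfy `P`. -/
def CorrectQuorum (E : Execution n) (P : Fin n → Prop) : Prop :=
  resilience n + 1 ≤ {q | E.Correct q ∧ P q}.ncard

/-- `p` has shown the clock-time of view `v` by time `τ`. -/
def Reaches (E : Execution n) (Γ : ℝ) (p : Fin n) (v : ℕ) (τ : ℝ) : Prop :=
  ∃ s, 0 ≤ s ∧ s ≤ τ ∧ E.clock p s = clockTime Γ v

/-- At least `t + 1` correct processors have shown the clock-time of view `v` by time `τ`. For
initial `v`, this is what is needed for a VC. -/
def QuorumReaches (E : Execution n) (Γ : ℝ) (v : ℕ) (τ : ℝ) : Prop :=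
  E.CorrectQuorum fun q => E.Reaches Γ q v τ

/-- By time `τ` there has been an event that makes `p` enter view `v`, unless `p` is already in a
higher view: for initial `v` the clock shows the clock-time of `v`, for other `v` a QC for the
preceding view arrives. -/
def Triggered (E : Execution n) (k : ℕ) (Γ : ℝ) (p : Fin n) (v : ℕ) (τ : ℝ) : Prop :=
  Initial k v ∧ E.Reaches Γ p v τ ∨ ¬ Initial k v ∧ ∃ u, v = u + 1 ∧ E.HasQC p u τ

/-- No correct clock has reached the clock-time of view `v` by GST. -/
def Fresh (E : Execution n) (Γ : ℝ) (v : ℕ) : Prop :=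
  ∀ p, E.Correct p → E.clock p E.gst < clockTime Γ v

/-- An execution of Fever alone, with no assumption on the underlying protocol; the gap `Γ` between
clock-times is an independent parameter. -/
structure FeverRun [NeZero n] (E : Execution n) (k : ℕ) (Γ δ : ℝ) : Prop where
  gamma_pos : 0 < Γ
  delta_pos : 0 < δ
  byz_card : E.byz.card ≤ resilience n
  network : E.PartialSynchrony δ
  clocks : E.PartialInitialClockSync Γ
  fever : E.FollowsFever k Γ

/-- An execution of Fever together with an underlying protocol that completes views in time `x δ`;
nothing relates `x δ` to `Γ`. -/
structure ProtocolRun [NeZero n] (E : Execution n) (k : ℕ) (Γ x δ : ℝ) (B : ℕ) : Prop extends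
    E.FeverRun k Γ δ where
  underlying : E.UnderlyingProtocol k x δ B

/-- An execution in which a block of `k` views is long enough for its leader: `Γ` until `t + 1`
correct processors have entered it, `2 δ` for the exchange of their messages and the VC, and `x δ`
for the completion of the initial view. -/
structure TimelyRun [NeZero n] (E : Execution n) (k : ℕ) (Γ x δ : ℝ) (B : ℕ) : Prop extends
    E.ProtocolRun k Γ x δ B where
  x_pos : 0 < x
  block_length : Γ + (2 + x) * δ ≤ k * Γ

theorem Reaches.mono (h : E.Reaches Γ p v σ) (hστ : σ ≤ τ) : E.Reaches Γ p v τ := by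
  obtain ⟨s, h0s, hsσ, hs⟩ := h
  exact ⟨s, h0s, hsσ.trans hστ, hs⟩

theorem HasQC.mono (h : E.HasQC p v σ) (hστ : σ ≤ τ) : E.HasQC p v τ := by
  obtain ⟨s, hsσ, hs⟩ := h
  exact ⟨s, hsσ.trans hστ, hs⟩

theorem Triggered.mono (h : E.Triggered k Γ p v σ) (hστ : σ ≤ τ) : E.Triggered k Γ p v τ :=
  h.imp (And.imp_right fun hr => hr.mono hστ)
    (And.imp_right fun ⟨u, hu, hq⟩ => ⟨u, hu, hq.mono hστ⟩)

namespace CorrectQuorum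

variable {P Q : Fin n → Prop}

theorem mono (h : E.CorrectQuorum P) (hPQ : ∀ q, E.Correct q → P q → Q q) : E.CorrectQuorum Q :=
  h.trans (Set.ncard_le_ncard (fun q hq => ⟨hq.1, hPQ q hq.1 hq.2⟩) (Set.toFinite _))

theorem exists_correct (h : E.CorrectQuorum P) : ∃ q, E.Correct q ∧ P q :=
  Set.nonempty_of_ncard_ne_zero (Nat.ne_of_gt (Nat.lt_of_lt_of_le (Nat.succ_pos _) h))

theorem of_forall_or (h : E.CorrectQuorum P)
    (hPQ : ∀ q, E.Correct q → P q → Q q ∨ E.CorrectQuorum Q) : E.CorrectQuorum Q := by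
  by_contra hQ
  exact hQ (h.mono fun q hq hPq => (hPQ q hq hPq).resolve_right hQ)

theorem exists_finset_of_not (hall : ∀ p, E.Correct p)
    (hP : ¬ E.CorrectQuorum P) :
    ∃ S : Finset (Fin n), n - resilience n ≤ S.card ∧ ∀ p ∈ S, ¬ P p := by
  classical
  refine ⟨(Finset.univ.filter P)ᶜ, ?_, fun p hp hPp => Finset.mem_compl.1 hp (by simpa using hPp)⟩
  have hfew : (Finset.univ.filter P).card ≤ resilience n := by
    rw [CorrectQuorum, not_le, Nat.lt_succ_iff] at hP
    refine le_trans ?_ hP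
    rw [← Set.ncard_coe_finset]
    exact Set.ncard_le_ncard (fun q hq => ⟨hall q, (Finset.mem_filter.1 hq).2⟩) (Set.toFinite _)
  rw [Finset.card_compl, Fintype.card_fin]
  exact Nat.sub_le_sub_left hfew n

end CorrectQuorum

theorem QuorumReaches.mono (h : E.QuorumReaches Γ v σ) (hστ : σ ≤ τ) : E.QuorumReaches Γ v τ :=
  CorrectQuorum.mono h fun _ _ hq => hq.mono hστ

theorem Fresh.mono (h : E.Fresh Γ v) (hΓ : 0 < Γ) (hvw : v ≤ w) : E.Fresh Γ w := fun p hp =>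
  (h p hp).trans_le ((clockTime_le_clockTime hΓ).2 hvw)

namespace PartialSynchrony

theorem finiteBelow_sent (h : E.PartialSynchrony δ) : FiniteBelow (Set.range E.sent) := fun T => by
  refine ((h.finite_sent T).image E.sent).subset ?_
  rintro _ ⟨⟨m, rfl⟩, hm⟩
  exact ⟨m, hm, rfl⟩

theorem finiteBelow_recv (h : E.PartialSynchrony δ) : FiniteBelow (Set.range E.recv) := fun T => by
  refine ((h.finite_sent T).image E.recv).subset ?_
  rintro _ ⟨⟨m, rfl⟩, hm⟩
  exact ⟨m, (h.sent_lt_recv m).le.trans hm, rfl⟩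

theorem recv_pos (h : E.PartialSynchrony δ) (m : E.Msg) : 0 < E.recv m :=
  (h.sent_nonneg m).trans_lt (h.sent_lt_recv m)

end PartialSynchrony

theorem RecvCert.mem_range_recv (h : E.RecvCert p v τ) : τ ∈ Set.range E.recv := by
  rcases h with ⟨m, -, hm, -⟩ | ⟨-, -, m, -, hm, -⟩ <;> exact ⟨m, hm⟩

theorem RecvQC.recvCert (h : E.RecvQC p u τ) : E.RecvCert p (u + 1) τ := Or.inr ⟨u, rfl, h⟩

theorem encard_le_of_injOn_fin {α : Type*} {s : Set α} {f : α → Fin n} (hf : Set.InjOn f s) :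
    s.encard ≤ n := by
  rw [← hf.encard_image]
  simpa using Set.encard_le_encard (Set.subset_univ (f '' s))

section Fever

variable [NeZero n]

/-! ### Clocks and views -/

namespace FeverRun

theorem recvCert_pos (h : E.FeverRun k Γ δ) (hc : E.RecvCert p v τ) : 0 < τ := by
  obtain ⟨m, rfl⟩ := hc.mem_range_recv
  exact h.network.recv_pos m

theorem clock_isGreatest (h : E.FeverRun k Γ δ) (hp : E.Correct p) (hτ : 0 ≤ τ) :
    IsGreatest ({E.clock p 0 + τ} ∪
      {c | ∃ v s, s ≤ τ ∧ E.RecvCert p v s ∧ c = clockTime Γ v + (τ - s)}) (E.clock p τ) := by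
  have hevents : FiniteBelow {s | ∃ v, E.RecvCert p v s} :=
    h.network.finiteBelow_recv.mono fun s ⟨v, hv⟩ => hv.mem_range_recv
  induction τ, hτ using hevents.step_induction with
  | zero =>
    refine ⟨Or.inl (add_zero _).symm, ?_⟩
    rintro c (rfl | ⟨v, s, hs, hcert, -⟩)
    exacts [(add_zero _).le, absurd hs (h.recvCert_pos hcert).not_ge]
  | step a b ha hab hnone ih =>
    obtain ⟨hmem, hub⟩ := h.fever.clock_step p hp a b ha hab
      fun s has hsb v hv => hnone s has hsb ⟨v, hv⟩
    have hrun : E.clock p a + (b - a) ≤ E.clock p b := hub (Or.inl rfl)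
    constructor
    · rcases hmem with heq | ⟨v, hv, heq⟩
      · rw [Set.mem_singleton_iff] at heq
        rcases ih.1 with hstart | ⟨v, s, hsa, hv, hs⟩
        · rw [Set.mem_singleton_iff] at hstart
          exact Or.inl (by rw [Set.mem_singleton_iff]; linarith)
        · exact Or.inr ⟨v, s, hsa.trans hab.le, hv, by linarith⟩
      · exact Or.inr ⟨v, b, le_rfl, hv, by linarith⟩
    · rintro c (rfl | ⟨v, s, hsb, hv, rfl⟩)
      · linarith [ih.2 (Or.inl rfl)]
      rcases hsb.eq_or_lt with rfl | hsb
      · linarith [hub (Or.inr ⟨v, hv, rfl⟩)]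
      rcases le_or_gt s a with hsa | has
      · linarith [ih.2 (Or.inr ⟨v, s, hsa, hv, rfl⟩)]
      · exact absurd ⟨v, hv⟩ (hnone s has hsb)

theorem clock_add_le (h : E.FeverRun k Γ δ) (hp : E.Correct p) (hσ : 0 ≤ σ) (hστ : σ ≤ τ) :
    E.clock p σ + (τ - σ) ≤ E.clock p τ := by
  have hub := (h.clock_isGreatest hp (hσ.trans hστ)).2
  rcases (h.clock_isGreatest hp hσ).1 with heq | ⟨v, s, hsσ, hv, heq⟩
  · rw [Set.mem_singleton_iff] at heq
    linarith [hub (Or.inl rfl)]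
  · linarith [hub (Or.inr ⟨v, s, hsσ.trans hστ, hv, rfl⟩)]

theorem clock_mono (h : E.FeverRun k Γ δ) (hp : E.Correct p) (hσ : 0 ≤ σ) (hστ : σ ≤ τ) :
    E.clock p σ ≤ E.clock p τ := by
  linarith [h.clock_add_le hp hσ hστ]

theorem clock_injOn (h : E.FeverRun k Γ δ) (hp : E.Correct p) :
    Set.InjOn (E.clock p) (Set.Ici 0) :=
  StrictMonoOn.injOn fun s hs r _ hsr => by
    linarith [h.clock_add_le hp hs hsr.le]

theorem finiteBelow_clockTime (h : E.FeverRun k Γ δ) (hp : E.Correct p) :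
    FiniteBelow {s | 0 ≤ s ∧ ∃ v, E.clock p s = clockTime Γ v} := fun T => by
  obtain ⟨N, hN⟩ := exists_nat_gt (E.clock p T / Γ)
  rw [div_lt_iff₀ h.gamma_pos] at hN
  refine Set.Finite.of_finite_image (f := E.clock p)
    (((Finset.range N).finite_toSet.image (clockTime Γ)).subset ?_)
    ((h.clock_injOn hp).mono fun s hs => hs.1.1)
  rintro _ ⟨s, ⟨⟨h0s, v, hv⟩, hsT⟩, rfl⟩
  refine ⟨v, ?_, hv.symm⟩
  have hlt : Γ * v < N * Γ := (hv.symm.trans_le (h.clock_mono hp h0s hsT)).trans_lt hN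
  rw [mul_comm, mul_lt_mul_iff_left₀ h.gamma_pos, Nat.cast_lt] at hlt
  exact Finset.mem_coe.2 (Finset.mem_range.2 hlt)

theorem clockTime_le_clock_of_recvCert (h : E.FeverRun k Γ δ) (hp : E.Correct p)
    (hc : E.RecvCert p v σ) (hστ : σ ≤ τ) : clockTime Γ v ≤ E.clock p τ := by
  linarith [(h.clock_isGreatest hp ((h.recvCert_pos hc).le.trans hστ)).2
    (Or.inr ⟨v, σ, hστ, hc, rfl⟩)]

theorem clockTime_le_clock_of_reaches (h : E.FeverRun k Γ δ) (hp : E.Correct p)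
    (hr : E.Reaches Γ p v τ) : clockTime Γ v ≤ E.clock p τ := by
  obtain ⟨s, h0s, hsτ, hs⟩ := hr
  exact hs.symm.trans_le (h.clock_mono hp h0s hsτ)

theorem clockTime_le_clock_of_triggered (h : E.FeverRun k Γ δ) (hp : E.Correct p)
    (ht : E.Triggered k Γ p v τ) : clockTime Γ v ≤ E.clock p τ := by
  rcases ht with ⟨-, hr⟩ | ⟨-, u, rfl, s, hsτ, hq⟩
  exacts [h.clockTime_le_clock_of_reaches hp hr,
    h.clockTime_le_clock_of_recvCert hp hq.recvCert hsτ]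

theorem exists_clock_eq_of_clockTime_le (h : E.FeverRun k Γ δ) (hp : E.Correct p) (hτ : 0 ≤ τ)
    (hc : clockTime Γ v ≤ E.clock p τ) :
    ∃ w s, v ≤ w ∧ 0 ≤ s ∧ s ≤ τ ∧ E.clock p s = clockTime Γ w ∧
      E.clock p τ = clockTime Γ w + (τ - s) ∧ (w = v ∨ v < w ∧ E.RecvCert p w s) := by
  have of_origin : ∀ s c, 0 ≤ s → c ≤ E.clock p s → c ≤ clockTime Γ v →
      E.clock p τ = c + (τ - s) →
      ∃ r, 0 ≤ r ∧ r ≤ τ ∧ E.clock p r = clockTime Γ v ∧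
        E.clock p τ = clockTime Γ v + (τ - r) := by
    intro s c hs hcs hcv heq
    refine ⟨s + (clockTime Γ v - c), by linarith, by linarith, ?_, by linarith⟩
    have hbefore := h.clock_add_le hp hs (τ := s + (clockTime Γ v - c)) (by linarith)
    have hafter := h.clock_add_le hp (σ := s + (clockTime Γ v - c)) (τ := τ) (by linarith)
      (by linarith)
    linarith
  rcases (h.clock_isGreatest hp hτ).1 with heq | ⟨w, s, hsτ, hcert, heq⟩
  · obtain ⟨r, hr0, hrτ, hr, hτr⟩ := of_origin 0 (E.clock p 0) le_rfl le_rfl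
      ((h.clocks.clock_zero_nonpos p hp).trans (clockTime_nonneg h.gamma_pos v))
      (by rwa [sub_zero])
    exact ⟨v, r, le_rfl, hr0, hrτ, hr, hτr, Or.inl rfl⟩
  have hs0 := (h.recvCert_pos hcert).le
  have hcs := h.clockTime_le_clock_of_recvCert hp hcert le_rfl
  rcases le_or_gt w v with hwv | hvw
  · obtain ⟨r, hr0, hrτ, hr, hτr⟩ := of_origin s (clockTime Γ w) hs0 hcs
      ((clockTime_le_clockTime h.gamma_pos).2 hwv) heq
    exact ⟨v, r, le_rfl, hr0, hrτ, hr, hτr, Or.inl rfl⟩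
  · have hrun := h.clock_add_le hp hs0 hsτ
    exact ⟨w, s, hvw.le, hs0, hsτ, by linarith, heq, Or.inr ⟨hvw, hcert⟩⟩

theorem view_isGreatest_of_clock_eq (h : E.FeverRun k Γ δ) (hp : E.Correct p) (hτ : 0 ≤ τ)
    (hv : Initial k v) (hc : E.clock p τ = clockTime Γ v) :
    IsGreatest (insert ⊥ ((↑) '' {w : ℕ | E.Triggered k Γ p w τ})) (E.view p τ) := by
  rw [h.fever.view_initial p hp v hv τ hτ hc]
  refine ⟨Or.inr ⟨v, Or.inl ⟨hv, τ, hτ, le_rfl, hc⟩, rfl⟩, ?_⟩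
  rintro _ (rfl | ⟨w, hw, rfl⟩)
  · exact bot_le
  · have hwv := (h.clockTime_le_clock_of_triggered hp hw).trans_eq hc
    exact WithBot.coe_le_coe.2 ((clockTime_le_clockTime h.gamma_pos).1 hwv)

theorem view_isGreatest_zero (h : E.FeverRun k Γ δ) (hp : E.Correct p) :
    IsGreatest (insert ⊥ ((↑) '' {w : ℕ | E.Triggered k Γ p w 0})) (E.view p 0) := by
  rcases (h.clocks.clock_zero_nonpos p hp).eq_or_lt with hzero | hneg
  · exact h.view_isGreatest_of_clock_eq hp le_rfl (Nat.zero_mod k)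
      (hzero.trans (clockTime_zero Γ).symm)
  · rw [h.fever.view_start p hp hneg]
    refine ⟨Or.inl rfl, ?_⟩
    rintro _ (rfl | ⟨w, hw, rfl⟩)
    · exact le_rfl
    · linarith [clockTime_nonneg h.gamma_pos w, h.clockTime_le_clock_of_triggered hp hw]

theorem view_isGreatest (h : E.FeverRun k Γ δ) (hp : E.Correct p) (hτ : 0 ≤ τ) :
    IsGreatest (insert ⊥ ((↑) '' {v : ℕ | E.Triggered k Γ p v τ})) (E.view p τ) := by
  have hevents := (h.finiteBelow_clockTime hp).union h.network.finiteBelow_recv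
  induction τ, hτ using hevents.step_induction with
  | zero => exact h.view_isGreatest_zero hp
  | step a b ha hab hnone ih =>
    by_cases hinit : ∃ v, Initial k v ∧ E.clock p b = clockTime Γ v
    · obtain ⟨v, hv, hc⟩ := hinit
      exact h.view_isGreatest_of_clock_eq hp (ha.trans hab.le) hv hc
    push Not at hinit
    obtain ⟨hmem, hub⟩ := h.fever.view_step p hp a b ha hab
      (fun s has hsb => ⟨fun v _ hc => hnone s has hsb (Or.inl ⟨ha.trans has.le, v, hc⟩),
        fun u ⟨m, _, hm, _⟩ => hnone s has hsb (Or.inr ⟨m, hm⟩)⟩) hinit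
    constructor
    · rcases hmem with heq | ⟨u, hu, hq, heq⟩
      · rw [Set.mem_singleton_iff] at heq
        rw [heq]
        exact ih.1.imp id fun ⟨w, hw, hwa⟩ => ⟨w, hw.mono hab.le, hwa⟩
      · exact Or.inr ⟨u + 1, Or.inr ⟨hu, u, rfl, b, le_rfl, hq⟩, heq.symm⟩
    rintro _ (rfl | ⟨w, hw, rfl⟩)
    · exact bot_le
    by_cases hwa : E.Triggered k Γ p w a
    · exact (ih.2 (Or.inr ⟨w, hwa, rfl⟩)).trans (hub (Or.inl rfl))
    rcases hw with ⟨hwi, s, h0s, hsb, hc⟩ | ⟨hwi, u, rfl, s, hsb, hq⟩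
    · rcases hsb.eq_or_lt with rfl | hsb
      · exact absurd hc (hinit w hwi)
      · have has : a < s := lt_of_not_ge fun hsa => hwa (Or.inl ⟨hwi, s, h0s, hsa, hc⟩)
        exact absurd (Or.inl ⟨h0s, w, hc⟩) (hnone s has hsb)
    · rcases hsb.eq_or_lt with rfl | hsb
      · exact hub (Or.inr ⟨u, hwi, hq, rfl⟩)
      · have has : a < s := lt_of_not_ge fun hsa => hwa (Or.inr ⟨hwi, u, rfl, s, hsa, hq⟩)
        exact absurd (Or.inr hq.recvCert.mem_range_recv) (hnone s has hsb)

theorem triggered_of_view (h : E.FeverRun k Γ δ) (hp : E.Correct p) (hτ : 0 ≤ τ)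
    (hview : E.view p τ = (v : WithBot ℕ)) : E.Triggered k Γ p v τ := by
  rcases (h.view_isGreatest hp hτ).1 with hbot | ⟨w, hw, heq⟩
  · exact absurd (hview.symm.trans hbot) WithBot.coe_ne_bot
  · obtain rfl : w = v := WithBot.coe_injective (heq.trans hview)
    exact hw

theorem le_view_of_triggered (h : E.FeverRun k Γ δ) (hp : E.Correct p) (hτ : 0 ≤ τ)
    (ht : E.Triggered k Γ p v τ) : (v : WithBot ℕ) ≤ E.view p τ :=
  (h.view_isGreatest hp hτ).2 (Or.inr ⟨v, ht, rfl⟩)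

theorem clockTime_le_clock_of_view (h : E.FeverRun k Γ δ) (hp : E.Correct p) (hτ : 0 ≤ τ)
    (hview : E.view p τ = (v : WithBot ℕ)) : clockTime Γ v ≤ E.clock p τ :=
  h.clockTime_le_clock_of_triggered hp (h.triggered_of_view hp hτ hview)

theorem exists_qc_of_view_succ (h : E.FeverRun k Γ δ) (hw : ¬ Initial k (w + 1)) (hp : E.Correct p)
    (hτ : 0 ≤ τ) (hview : E.view p τ = ((w + 1 : ℕ) : WithBot ℕ)) :
    ∃ m, E.CarriesQC m w ∧ E.sent m < τ := by
  rcases h.triggered_of_view hp hτ hview with ⟨hi, -⟩ | ⟨-, u, hwu, s, hsτ, m, -, rfl, hm⟩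
  · exact absurd hi hw
  · obtain rfl : w = u := Nat.succ_injective hwu
    exact ⟨m, hm, (h.network.sent_lt_recv m).trans_le hsτ⟩

theorem viewMonotone (h : E.FeverRun k Γ δ) : E.ViewMonotone := by
  intro p hp s τ hs hsτ
  cases hview : E.view p s with
  | bot => exact bot_le
  | coe v =>
    exact h.le_view_of_triggered hp (hs.trans hsτ) ((h.triggered_of_view hp hs hview).mono hsτ)

theorem exists_correct_mem (h : E.FeverRun k Γ δ) {S : Finset (Fin n)}
    (hS : resilience n + 1 ≤ S.card) : ∃ q ∈ S, E.Correct q :=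
  Finset.exists_mem_notMem_of_card_lt_card (h.byz_card.trans_lt hS)

theorem le_card_compl_byz (h : E.FeverRun k Γ δ) : n - resilience n ≤ E.byzᶜ.card := by
  rw [Finset.card_compl, Fintype.card_fin]
  exact Nat.sub_le_sub_left h.byz_card n

theorem exists_correct (h : E.FeverRun k Γ δ) : ∃ q, E.Correct q := by
  have := three_mul_resilience_lt n
  have := h.le_card_compl_byz
  obtain ⟨q, hq⟩ : E.byzᶜ.Nonempty := Finset.card_pos.1 (by omega)
  exact ⟨q, Finset.mem_compl.1 hq⟩

theorem exists_clock_eq_of_vc (h : E.FeverRun k Γ δ) (hm : E.content m = Content.vc v) :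
    Initial k v ∧ ∃ q m', E.Correct q ∧ E.sent m' ≤ E.sent m ∧
      E.clock q (E.sent m') = clockTime Γ v := by
  obtain ⟨S, hS, hsigned⟩ := h.fever.vc_sound m v hm
  obtain ⟨q, hqS, hq⟩ := h.exists_correct_mem hS
  obtain ⟨m', hsrc, hcontent, hsent⟩ := hsigned q hqS hq
  obtain ⟨-, hv, -, hclock⟩ := (h.fever.view_message q hq (E.dst m') v (E.sent m')).1
    ⟨m', hsrc, rfl, hcontent, rfl⟩
  exact ⟨hv, q, m', hq, hsent, hclock⟩

theorem le_view_of_clockTime_le (h : E.FeverRun k Γ δ) (hv : Initial k v) (hp : E.Correct p)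
    (hτ : 0 ≤ τ) (hc : clockTime Γ v ≤ E.clock p τ) : (v : WithBot ℕ) ≤ E.view p τ := by
  obtain ⟨w, s, hvw, h0s, hsτ, hs, -, horigin⟩ := h.exists_clock_eq_of_clockTime_le hp hτ hc
  refine (WithBot.coe_le_coe.2 hvw).trans (h.le_view_of_triggered hp hτ ?_)
  by_cases hw : Initial k w
  · exact Or.inl ⟨hw, s, h0s, hsτ, hs⟩
  rcases horigin with rfl | ⟨-, ⟨m, -, -, hm⟩ | ⟨u, rfl, hq⟩⟩
  exacts [absurd hv hw, absurd (h.exists_clock_eq_of_vc hm).1 hw,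
    Or.inr ⟨hw, u, rfl, s, hsτ, hq⟩]

/-- In the last case the VC that set the clock of `p` rests on the `view` message of `q`. -/
theorem clock_provenance (h : E.FeverRun k Γ δ) (hp : E.Correct p) (hτ : 0 ≤ τ)
    (hc : clockTime Γ v ≤ E.clock p τ) :
    (∃ s, 0 ≤ s ∧ s ≤ τ ∧ E.clock p s = clockTime Γ v ∧
      E.clock p τ = clockTime Γ v + (τ - s)) ∨
    (∃ m u, v ≤ u ∧ E.sent m < τ ∧ E.CarriesQC m u) ∨
    ∃ q m, E.Correct q ∧ E.sent m < τ ∧ clockTime Γ (v + 1) ≤ E.clock q (E.sent m) ∧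
      E.clock p τ ≤ E.clock q (E.sent m) + (τ - E.sent m) := by
  obtain ⟨w, s, hvw, h0s, hsτ, hs, heq, rfl | ⟨hlt, ⟨m, -, rfl, hm⟩ | ⟨u, rfl, m, -, rfl, hm⟩⟩⟩ :=
    h.exists_clock_eq_of_clockTime_le hp hτ hc
  · exact Or.inl ⟨s, h0s, hsτ, hs, heq⟩
  · obtain ⟨-, q, m', hq, hsent, hclock⟩ := h.exists_clock_eq_of_vc hm
    have hm'τ : E.sent m' < E.recv m := hsent.trans_lt (h.network.sent_lt_recv m)
    refine Or.inr (Or.inr ⟨q, m', hq, hm'τ.trans_le hsτ, ?_, by linarith⟩)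
    rw [hclock, clockTime_le_clockTime h.gamma_pos]
    exact hlt
  · exact Or.inr (Or.inl ⟨m, u, Nat.le_of_lt_succ hlt, (h.network.sent_lt_recv m).trans_le hsτ, hm⟩)

theorem exists_clock_eq_of_no_qc (h : E.FeverRun k Γ δ) (hp : E.Correct p) (hτ : 0 ≤ τ)
    (hc : clockTime Γ v ≤ E.clock p τ)
    (hno : ∀ m u, E.sent m < τ → v ≤ u → ¬ E.CarriesQC m u) :
    ∃ q s, E.Correct q ∧ 0 ≤ s ∧ E.clock q s = clockTime Γ v ∧
      E.clock p τ ≤ clockTime Γ v + (τ - s) := by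
  induction τ using h.network.finiteBelow_sent.strong_induction generalizing p with
  | step τ ih =>
  rcases h.clock_provenance hp hτ hc with
    ⟨s, h0s, -, hs, heq⟩ | ⟨m, u, hvu, hm, hqc⟩ | ⟨q, m, hq, hm, hcq, hle⟩
  · exact ⟨p, s, hp, h0s, hs, heq.le⟩
  · exact absurd hqc (hno m u hm hvu)
  · have hvq : clockTime Γ v ≤ E.clock q (E.sent m) := by
      linarith [clockTime_succ Γ v, h.gamma_pos]
    obtain ⟨r, s, hr, h0s, hs, hrun⟩ := ih _ ⟨m, rfl⟩ hm hq (h.network.sent_nonneg m) hvq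
      fun m' u hm' => hno m' u (hm'.trans hm)
    exact ⟨r, s, hr, h0s, hs, by linarith⟩

theorem exists_first_entry (h : E.FeverRun k Γ δ) (hp : E.Correct p) (hτ : 0 ≤ τ)
    (hc : clockTime Γ v ≤ E.clock p τ)
    (hno : ∀ m u, E.sent m < τ → v ≤ u → ¬ E.CarriesQC m u) :
    ∃ q₀ s₀, E.Correct q₀ ∧ 0 ≤ s₀ ∧ E.clock q₀ s₀ = clockTime Γ v ∧
      ∀ q, E.Correct q → ∀ s, 0 ≤ s → s ≤ τ → clockTime Γ v ≤ E.clock q s →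
        E.clock q s ≤ clockTime Γ v + (s - s₀) := by
  have hfin : FiniteBelow {s | ∃ q, E.Correct q ∧ 0 ≤ s ∧ E.clock q s = clockTime Γ v} :=
    (FiniteBelow.iUnion fun q : {q // E.Correct q} => h.finiteBelow_clockTime q.2).mono
      fun s ⟨q, hq, h0s, hs⟩ => Set.mem_iUnion.2 ⟨⟨q, hq⟩, h0s, v, hs⟩
  obtain ⟨q₁, s₁, hq₁, h0s₁, hs₁, -⟩ := h.exists_clock_eq_of_no_qc hp hτ hc hno
  obtain ⟨s₀, ⟨q₀, hq₀, h0s₀, hs₀⟩, hmin⟩ := hfin.exists_isLeast ⟨s₁, q₁, hq₁, h0s₁, hs₁⟩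
  refine ⟨q₀, s₀, hq₀, h0s₀, hs₀, fun q hq s h0s hsτ hcs => ?_⟩
  obtain ⟨r, s', hr, h0s', hs', hle⟩ := h.exists_clock_eq_of_no_qc hq h0s hcs
    fun m u hm => hno m u (hm.trans_le hsτ)
  linarith [hmin ⟨r, hr, h0s', hs'⟩]

theorem isLeast_viewSenders (h : E.FeverRun k Γ δ)
    (hτ : resilience n + 1 ≤ (E.viewSenders p v τ).ncard) :
    ∃ σ ≤ τ, IsLeast {s : ℝ | resilience n + 1 ≤ (E.viewSenders p v s).ncard} σ := by
  set A := {s : ℝ | resilience n + 1 ≤ (E.viewSenders p v s).ncard}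
  have hdown : ∀ s ∈ A, ∃ r ∈ A ∩ Set.range E.recv, r ≤ s := by
    intro s hs
    obtain ⟨_, m₀, -, -, -, hm₀⟩ : (E.viewSenders p v s).Nonempty :=
      Set.nonempty_of_ncard_ne_zero (Nat.ne_of_gt (Nat.lt_of_lt_of_le (Nat.succ_pos _) hs))
    obtain ⟨r, ⟨hr, hrs⟩, hmax⟩ := Set.exists_max_image _ id (h.network.finiteBelow_recv s)
      ⟨E.recv m₀, ⟨m₀, rfl⟩, hm₀⟩
    refine ⟨r, ⟨le_trans hs (Set.ncard_le_ncard ?_ (Set.toFinite _)), hr⟩, hrs⟩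
    rintro q ⟨m, hsrc, hdst, hcontent, hm⟩
    exact ⟨m, hsrc, hdst, hcontent, hmax _ ⟨⟨m, rfl⟩, hm⟩⟩
  obtain ⟨r, hr, hrτ⟩ := hdown τ hτ
  obtain ⟨σ, hσ, hmin⟩ :=
    (h.network.finiteBelow_recv.mono Set.inter_subset_right).exists_isLeast ⟨r, hr⟩
  refine ⟨σ, (hmin hr).trans hrτ, hσ.1, fun s hs => ?_⟩
  obtain ⟨r', hr', hr's⟩ := hdown s hs
  exact (hmin hr').trans hr's

theorem exists_vc_time (h : E.FeverRun k Γ δ) (hv : Initial k v) (hl : E.Correct (lead n k v))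
    (hq : E.QuorumReaches Γ v τ) :
    ∃ σ ≤ max E.gst τ + δ,
      IsLeast {s : ℝ | resilience n + 1 ≤ (E.viewSenders (lead n k v) v s).ncard} σ := by
  refine h.isLeast_viewSenders (le_trans hq (Set.ncard_le_ncard ?_ (Set.toFinite _)))
  rintro q ⟨hq, s, h0s, hsτ, hs⟩
  obtain ⟨m, hsrc, hdst, hcontent, rfl⟩ := (h.fever.view_message q hq (lead n k v) v s).2
    ⟨h0s, hv, rfl, hs⟩
  exact ⟨m, hsrc, hdst, hcontent, (h.network.delay m (hsrc ▸ hq) (hdst ▸ hl)).trans (by gcongr)⟩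

theorem clockTime_le_clock_of_quorumReaches (h : E.FeverRun k Γ δ) (hv : Initial k v)
    (hl : E.Correct (lead n k v)) (hq : E.QuorumReaches Γ v σ) (hp : E.Correct p)
    (hτ : max E.gst σ + 2 * δ ≤ τ) : clockTime Γ v ≤ E.clock p τ := by
  obtain ⟨r, hr, hleast⟩ := h.exists_vc_time hv hl hq
  obtain ⟨m, hsrc, hdst, hcontent, rfl⟩ := (h.fever.vc_message _ hl p v r).2 ⟨hv, rfl, hleast⟩
  have hrecv := h.network.delay m (hsrc ▸ hl) (hdst ▸ hp)
  have hsent : max E.gst (E.sent m) ≤ max E.gst σ + δ :=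
    max_le (by linarith [le_max_left E.gst σ, h.delta_pos]) hr
  exact h.clockTime_le_clock_of_recvCert hp (Or.inl ⟨m, hdst, rfl, hcontent⟩) (by linarith)

theorem exists_fresh (h : E.FeverRun k Γ δ) : ∃ v, E.Fresh Γ v := by
  obtain ⟨C, hC⟩ := (Set.finite_range fun p => E.clock p E.gst).bddAbove
  obtain ⟨v, hv⟩ := exists_nat_gt (C / Γ)
  rw [div_lt_iff₀ h.gamma_pos, mul_comm] at hv
  exact ⟨v, fun p _ => (hC ⟨p, rfl⟩).trans_lt hv⟩

/-- The blocks `a, …, a + f` have distinct leaders, as `f < n`. -/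
theorem exists_correct_lead (h : E.FeverRun k Γ δ) (hk : 0 < k) (a : ℕ) :
    ∃ j, a ≤ j ∧ j ≤ a + E.byz.card ∧ E.Correct (lead n k (k * j)) := by
  have hf : E.byz.card < n := by
    have := h.byz_card
    have := three_mul_resilience_lt n
    omega
  have hinj : Set.InjOn (lead n k <| k * ·) (Finset.Icc a (a + E.byz.card)) := by
    intro i hi j hj hij
    simp only [lead, Nat.mul_div_cancel_left _ hk] at hij
    rw [Finset.coe_Icc, Set.mem_Icc] at hi hj
    have hmod : i ≡ j [MOD n] := congrArg Fin.val hij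
    rcases le_total i j with hle | hle
    · have := Nat.eq_zero_of_dvd_of_lt ((Nat.modEq_iff_dvd' hle).1 hmod) (by omega)
      omega
    · have := Nat.eq_zero_of_dvd_of_lt ((Nat.modEq_iff_dvd' hle).1 hmod.symm) (by omega)
      omega
  obtain ⟨q, hq, hqc⟩ := Finset.exists_mem_notMem_of_card_lt_card
    (s := E.byz) (t := (Finset.Icc a (a + E.byz.card)).image (lead n k <| k * ·))
    (by rw [Finset.card_image_of_injOn hinj, Nat.card_Icc]; omega)
  obtain ⟨j, hj, rfl⟩ := Finset.mem_image.1 hq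
  exact ⟨j, (Finset.mem_Icc.1 hj).1, (Finset.mem_Icc.1 hj).2, hqc⟩

theorem exists_fresh_correct_lead (h : E.FeverRun k Γ δ) (hk : 0 < k) :
    ∃ v, Initial k v ∧ E.Correct (lead n k v) ∧ E.Fresh Γ v := by
  obtain ⟨a, ha⟩ := h.exists_fresh
  obtain ⟨j, haj, -, hl⟩ := h.exists_correct_lead hk a
  exact ⟨k * j, initial_mul k j, hl,
    ha.mono h.gamma_pos (haj.trans (Nat.le_mul_of_pos_left j hk))⟩

theorem exists_isLeast_fresh (h : E.FeverRun k Γ δ) (hk : 0 < k) :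
    ∃ b, IsLeast {b | E.Fresh Γ (k * b)} b := by
  obtain ⟨v, hv⟩ := h.exists_fresh
  have hne : {b | E.Fresh Γ (k * b)}.Nonempty :=
    ⟨v, hv.mono h.gamma_pos (Nat.le_mul_of_pos_left v hk)⟩
  exact ⟨_, Nat.sInf_mem hne, fun _ => Nat.sInf_le⟩

end FeverRun

/-! ### Quorum certificates -/

theorem firstQC_le {r : ℝ} (hr : E.Produces k v r) (hl : E.Correct (lead n k v))
    (hgr : E.gst < r) : E.firstQC k ≤ (r : EReal) :=
  sInf_le ⟨r, v, rfl, hgr, hl, hr⟩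

theorem latency_le_of_firstQC_le {d : ℝ} (hd : E.firstQC k ≤ ((E.gst + d : ℝ) : EReal)) :
    E.latency k ≤ (d : EReal) := by
  refine (EReal.sub_le_sub hd le_rfl).trans ?_
  rw [← EReal.coe_sub, add_sub_cancel_left]

namespace ProtocolRun

theorem correctQuorum_of_qc (h : E.ProtocolRun k Γ x δ B) (hm : E.CarriesQC m u) :
    E.CorrectQuorum fun q => ∃ s, 0 ≤ s ∧ s ≤ E.sent m ∧ E.view q s = (u : WithBot ℕ) := by
  obtain ⟨S, hS, hsigned⟩ := h.underlying.qc_sound m u hm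
  have hcard : resilience n + 1 ≤ (S \ E.byz).card := by
    have := Finset.le_card_sdiff E.byz S
    have := h.byz_card
    have := three_mul_resilience_lt n
    omega
  rw [← Set.ncard_coe_finset] at hcard
  refine hcard.trans (Set.ncard_le_ncard (fun q hq => ?_) (Set.toFinite _))
  obtain ⟨hqS, hqb⟩ := Finset.mem_sdiff.1 (Finset.mem_coe.1 hq)
  exact ⟨hqb, hsigned q hqS hqb⟩

theorem exists_clock_of_qc (h : E.ProtocolRun k Γ x δ B) (hm : E.CarriesQC m u) :
    ∃ q, E.Correct q ∧ clockTime Γ u ≤ E.clock q (E.sent m) := by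
  obtain ⟨q, hq, s, h0s, hs, hview⟩ := (h.correctQuorum_of_qc hm).exists_correct
  exact ⟨q, hq, (h.clockTime_le_clock_of_view hq h0s hview).trans (h.clock_mono hq h0s hs)⟩

theorem correctQuorum_clock (h : E.ProtocolRun k Γ x δ B) (hp : E.Correct p) (hτ : 0 ≤ τ) :
    E.CorrectQuorum fun q => E.clock p τ - Γ ≤ E.clock q τ := by
  induction τ using h.network.finiteBelow_sent.strong_induction generalizing p with
  | step τ ih =>
  rcases (h.clock_isGreatest hp hτ).1 with heq | ⟨v, s, hsτ, hcert, heq⟩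
  · rw [Set.mem_singleton_iff] at heq
    refine CorrectQuorum.mono (h.clocks.clock_zero_sync p hp) fun q hq hle => ?_
    linarith [h.clock_add_le hq le_rfl hτ]
  rcases hcert with ⟨m, -, rfl, hm⟩ | ⟨u, rfl, m, -, rfl, hm⟩
  · obtain ⟨-, q, m', hq, hsent, hclock⟩ := h.exists_clock_eq_of_vc hm
    have hm'τ : E.sent m' < τ := (hsent.trans_lt (h.network.sent_lt_recv m)).trans_le hsτ
    have h0 := h.network.sent_nonneg m'
    refine (ih _ ⟨m', rfl⟩ hm'τ hq h0).mono fun r hr hle => ?_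
    linarith [h.clock_add_le hr h0 hm'τ.le, h.network.sent_lt_recv m]
  · have hrecv := h.network.sent_lt_recv m
    refine (h.correctQuorum_of_qc hm).mono fun r hr ⟨s, h0s, hs, hview⟩ => ?_
    linarith [h.clock_add_le hr h0s (hs.trans (hrecv.le.trans hsτ)), clockTime_succ Γ u,
      h.clockTime_le_clock_of_view hr h0s hview]

theorem quorumReaches_or_exists_clock_of_qc (h : E.ProtocolRun k Γ x δ B) (hv : Initial k v)
    (hvu : v ≤ u) (hm : E.CarriesQC m u) :
    E.QuorumReaches Γ v (E.sent m) ∨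
      ∃ q, E.Correct q ∧ clockTime Γ (v + 1) ≤ E.clock q (E.sent m) := by
  rcases hvu.eq_or_lt with rfl | hlt
  · refine Or.inl ((h.correctQuorum_of_qc hm).mono fun q hq ⟨s, h0s, hs, hview⟩ => ?_)
    rcases h.triggered_of_view hq h0s hview with ⟨-, hr⟩ | ⟨hni, -⟩
    exacts [hr.mono hs, absurd hv hni]
  · obtain ⟨q, hq, hc⟩ := h.exists_clock_of_qc hm
    exact Or.inr ⟨q, hq, ((clockTime_le_clockTime h.gamma_pos).2 hlt).trans hc⟩

theorem reaches_or_quorumReaches (h : E.ProtocolRun k Γ x δ B) (hv : Initial k v)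
    (hp : E.Correct p) (hτ : 0 ≤ τ) (hc : clockTime Γ v ≤ E.clock p τ) :
    E.Reaches Γ p v τ ∨ E.QuorumReaches Γ v τ := by
  induction τ using h.network.finiteBelow_sent.strong_induction generalizing p with
  | step τ ih =>
  have of_ahead : ∀ m q, E.sent m < τ → E.Correct q →
      clockTime Γ (v + 1) ≤ E.clock q (E.sent m) → E.QuorumReaches Γ v τ := by
    intro m q hm hq hcq
    have h0 := h.network.sent_nonneg m
    refine QuorumReaches.mono ((h.correctQuorum_clock hq h0).of_forall_or fun r hr hle => ?_) hm.le
    exact ih _ ⟨m, rfl⟩ hm hr h0 (by linarith [clockTime_succ Γ v])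
  rcases h.clock_provenance hp hτ hc with
    ⟨s, h0s, hsτ, hs, -⟩ | ⟨m, u, hvu, hm, hqc⟩ | ⟨q, m, hq, hm, hcq, -⟩
  · exact Or.inl ⟨s, h0s, hsτ, hs⟩
  · rcases h.quorumReaches_or_exists_clock_of_qc hv hvu hqc with hqr | ⟨q, hq, hcq⟩
    exacts [Or.inr (hqr.mono hm.le), Or.inr (of_ahead m q hm hq hcq)]
  · exact Or.inr (of_ahead m q hm hq hcq)

theorem quorumReaches_of_clock (h : E.ProtocolRun k Γ x δ B) (hv : Initial k v) (hp : E.Correct p)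
    (hτ : 0 ≤ τ) (hc : clockTime Γ (v + 1) ≤ E.clock p τ) : E.QuorumReaches Γ v τ :=
  (h.correctQuorum_clock hp hτ).of_forall_or fun _ hq hle =>
    h.reaches_or_quorumReaches hv hq hτ (by linarith [clockTime_succ Γ v])

theorem quorumReaches_of_qc (h : E.ProtocolRun k Γ x δ B) (hv : Initial k v) (hvu : v ≤ u)
    (hm : E.CarriesQC m u) : E.QuorumReaches Γ v (E.sent m) := by
  rcases h.quorumReaches_or_exists_clock_of_qc hv hvu hm with hqr | ⟨q, hq, hc⟩
  exacts [hqr, h.quorumReaches_of_clock hv hq (h.network.sent_nonneg m) hc]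

theorem exists_qc_of_le (h : E.ProtocolRun k Γ x δ B) (hv : Initial k v) (hvw : v ≤ w)
    (hwu : w ≤ u) (huk : u < v + k) (hm : E.CarriesQC m u) :
    ∃ m', E.CarriesQC m' w ∧ E.sent m' ≤ E.sent m := by
  induction u, hwu using Nat.le_induction generalizing m with
  | base => exact ⟨m, hm, le_rfl⟩
  | succ u hwu ih =>
    obtain ⟨q, hq, s, h0s, hs, hview⟩ := (h.correctQuorum_of_qc hm).exists_correct
    obtain ⟨m₁, hm₁, hm₁s⟩ :=
      h.exists_qc_of_view_succ (not_initial_of_lt hv (by omega) huk) hq h0s hview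
    obtain ⟨m', hm', hle⟩ := ih (by omega) hm₁
    exact ⟨m', hm', hle.trans (hm₁s.le.trans hs)⟩

theorem exists_qc_of_view (h : E.ProtocolRun k Γ x δ B) (hv : Initial k v) (hvw : v ≤ w)
    (hwu : w < u) (huk : u < v + k) (hp : E.Correct p) (hτ : 0 ≤ τ)
    (hview : E.view p τ = (u : WithBot ℕ)) : ∃ m, E.CarriesQC m w ∧ E.sent m < τ := by
  obtain ⟨d, rfl⟩ := Nat.exists_eq_add_of_lt hwu
  obtain ⟨m₁, hm₁, hm₁τ⟩ :=
    h.exists_qc_of_view_succ (not_initial_of_lt hv (by omega) huk) hp hτ hview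
  obtain ⟨m, hm, hle⟩ := h.exists_qc_of_le hv hvw (by omega) (by omega) hm₁
  exact ⟨m, hm, hle.trans_lt hm₁τ⟩

theorem view_eq_of_no_qc (h : E.ProtocolRun k Γ x δ B) (hv : Initial k v) (hvw : v ≤ w)
    (hp : E.Correct p) (hτ : 0 ≤ τ) (hview : (w : WithBot ℕ) ≤ E.view p τ)
    (hc : E.clock p τ < clockTime Γ (v + k)) (hno : ∀ m, E.sent m < τ → ¬ E.CarriesQC m w) :
    E.view p τ = (w : WithBot ℕ) := by
  obtain ⟨u, hu, hwu⟩ := WithBot.coe_le_iff.1 hview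
  have huk : u < v + k := lt_of_not_ge fun hku => hc.not_ge
    (((clockTime_le_clockTime h.gamma_pos).2 hku).trans (h.clockTime_le_clock_of_view hp hτ hu))
  rcases hwu.eq_or_lt with rfl | hlt
  · exact hu
  · obtain ⟨m, hm, hmτ⟩ := h.exists_qc_of_view hv hvw hlt huk hp hτ hu
    exact absurd hm (hno m hmτ)

theorem exists_qc_of_le_view (h : E.ProtocolRun k Γ x δ B) (hv : Initial k v)
    (hl : E.Correct (lead n k v)) (hvw : v ≤ w) (hwk : w < v + k) {a : ℝ} (ha : E.gst ≤ a)
    {S : Finset (Fin n)} (hS : n - resilience n ≤ S.card) (hSc : ∀ p ∈ S, E.Correct p)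
    (hstay : ∀ p ∈ S, ∀ s, a ≤ s → s < a + x * δ →
      (w : WithBot ℕ) ≤ E.view p s ∧ E.clock p s < clockTime Γ (v + k)) :
    ∃ m, E.CarriesQC m w ∧ E.sent m < a + x * δ := by
  by_contra! hno
  have hin : ∀ p ∈ S, E.Correct p ∧ E.InViewUntilQC p w a (a + x * δ) := by
    refine fun p hp => ⟨hSc p hp, fun s has hs => Or.inl ?_⟩
    obtain ⟨hview, hc⟩ := hstay p hp s has hs
    exact h.view_eq_of_no_qc hv hvw (hSc p hp) (h.network.gst_nonneg.trans (ha.trans has)) hview hc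
      fun m hm hqc => (hno m hqc).not_gt (hm.trans hs)
  obtain ⟨q, hq⟩ := h.exists_correct
  obtain ⟨s, hs, m, -, rfl, hm⟩ :=
    h.underlying.sufficient_time w a (by rwa [lead_eq_of_initial hv hvw hwk]) ha ⟨S, hS, hin⟩ q hq
  exact (hno m hm).not_gt ((h.network.sent_lt_recv m).trans_le hs)

theorem exists_produces (h : E.ProtocolRun k Γ x δ B) (hl : E.Correct (lead n k v))
    (hm : E.CarriesQC m v) : ∃ r ≤ E.sent m, E.Produces k v r := by
  obtain ⟨m', hsrc, hm', hle⟩ := h.underlying.qc_leader m v hl hm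
  have hfin : FiniteBelow {s | ∃ m, E.src m = lead n k v ∧ E.CarriesQC m v ∧ E.sent m = s} :=
    h.network.finiteBelow_sent.mono fun s ⟨m, _, _, hs⟩ => ⟨m, hs⟩
  obtain ⟨r, hr⟩ := hfin.exists_isLeast ⟨_, m', hsrc, hm', rfl⟩
  exact ⟨r, (hr.2 ⟨m', hsrc, hm', rfl⟩).trans hle, hr⟩

theorem hasQC_of_produces (h : E.ProtocolRun k Γ x δ B) (hl : E.Correct (lead n k v))
    (hr : E.Produces k v σ) (hp : E.Correct p) (hτ : max E.gst σ + δ ≤ τ) : E.HasQC p v τ := by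
  obtain ⟨m, hsrc, hdst, hm, rfl⟩ := h.underlying.qc_broadcast v σ hl hr p
  exact ⟨E.recv m, (h.network.delay m (hsrc ▸ hl) (hdst ▸ hp)).trans hτ, m, hdst, rfl, hm⟩

theorem gst_lt_of_qc (h : E.ProtocolRun k Γ x δ B) (hfresh : E.Fresh Γ v)
    (hm : E.CarriesQC m v) : E.gst < E.sent m := by
  obtain ⟨q, hq, hc⟩ := h.exists_clock_of_qc hm
  by_contra! hle
  exact (hfresh q hq).not_ge (hc.trans (h.clock_mono hq (h.network.sent_nonneg m) hle))

theorem firstQC_le_of_qc (h : E.ProtocolRun k Γ x δ B) (hfresh : E.Fresh Γ v)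
    (hl : E.Correct (lead n k v)) (hm : E.CarriesQC m v) : E.firstQC k ≤ (E.sent m : EReal) := by
  obtain ⟨r, hle, hr⟩ := h.exists_produces hl hm
  obtain ⟨m', -, hm', rfl⟩ := hr.1
  exact (firstQC_le hr hl (h.gst_lt_of_qc hfresh hm')).trans (EReal.coe_le_coe_iff.2 hle)

theorem exists_produces_le_gst (h : E.ProtocolRun k Γ x δ B) (hl : E.Correct (lead n k v))
    (hm : E.CarriesQC m v) (hquiet : (E.sent m : EReal) < E.firstQC k) :
    ∃ r ≤ E.gst, E.Produces k v r := by
  obtain ⟨r, hle, hr⟩ := h.exists_produces hl hm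
  refine ⟨r, le_of_not_gt fun hgr => hquiet.not_ge ?_, hr⟩
  exact (firstQC_le hr hl hgr).trans (EReal.coe_le_coe_iff.2 hle)

end ProtocolRun

/-! ### Progress in a block with correct leader -/

namespace TimelyRun

theorem k_pos (h : E.TimelyRun k Γ x δ B) : 0 < k := by
  have hδ : 0 < (2 + x) * δ := mul_pos (by linarith [h.x_pos]) h.delta_pos
  have hkΓ : 0 < k * Γ := by linarith [h.block_length, h.gamma_pos]
  exact_mod_cast pos_of_mul_pos_left hkΓ h.gamma_pos.le

theorem exists_qc_of_first_entry (h : E.TimelyRun k Γ x δ B) (hv : Initial k v)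
    (hl : E.Correct (lead n k v)) (hq : E.Correct q) (hσ : E.gst ≤ σ)
    (hentry : E.clock q σ = clockTime Γ v)
    (hslow : ∀ p, E.Correct p → ∀ s, 0 ≤ s → s ≤ σ + k * Γ → clockTime Γ v ≤ E.clock p s →
      E.clock p s ≤ clockTime Γ v + (s - σ)) :
    ∃ m, E.CarriesQC m v ∧ E.sent m < σ + k * Γ := by
  have hΓ := h.gamma_pos
  have hδ := h.delta_pos
  have hblock := h.block_length
  have h0σ := h.network.gst_nonneg.trans hσ
  have hquorum : E.QuorumReaches Γ v (σ + Γ) := by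
    refine h.quorumReaches_of_clock hv hq (by linarith) ?_
    linarith [h.clock_add_le hq h0σ (τ := σ + Γ) (by linarith), clockTime_succ Γ v]
  have hentered : ∀ p, E.Correct p → ∀ s, σ + Γ + 2 * δ ≤ s → clockTime Γ v ≤ E.clock p s :=
    fun p hp s hs => h.clockTime_le_clock_of_quorumReaches hv hl hquorum hp
      (by rwa [max_eq_right (by linarith)])
  obtain ⟨m, hm, hms⟩ := h.exists_qc_of_le_view hv hl le_rfl (Nat.lt_add_of_pos_right h.k_pos)
    (a := σ + Γ + 2 * δ) (by linarith) h.le_card_compl_byz (fun p => Finset.mem_compl.1)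
    fun p hp s hs hsx => by
      have hp := Finset.mem_compl.1 hp
      have hcs := hentered p hp s hs
      refine ⟨h.le_view_of_clockTime_le hv hp (by linarith) hcs, ?_⟩
      linarith [hslow p hp s (by linarith) (by linarith) hcs, clockTime_add Γ v k]
  exact ⟨m, hm, by linarith⟩

theorem exists_qc_of_clock (h : E.TimelyRun k Γ x δ B) (hv : Initial k v)
    (hl : E.Correct (lead n k v)) (hfresh : E.Fresh Γ v) (hp : E.Correct p) (hτ : 0 ≤ τ)
    (hc : clockTime Γ (v + k) ≤ E.clock p τ) : ∃ m, E.CarriesQC m v ∧ E.sent m < τ := by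
  induction τ using h.network.finiteBelow_sent.strong_induction generalizing p with
  | step τ ih =>
  by_contra! hno
  have hno_later : ∀ m u, E.sent m < τ → v ≤ u → ¬ E.CarriesQC m u := by
    intro m u hm hvu hqc
    rcases lt_or_ge u (v + k) with huk | hku
    · obtain ⟨m', hm', hle⟩ := h.exists_qc_of_le hv le_rfl hvu huk hqc
      exact (hno m' hm').not_gt (hle.trans_lt hm)
    · obtain ⟨q, hq, hcq⟩ := h.exists_clock_of_qc hqc
      obtain ⟨m', hm', hlt⟩ := ih _ ⟨m, rfl⟩ hm hq (h.network.sent_nonneg m)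
        (((clockTime_le_clockTime h.gamma_pos).2 hku).trans hcq)
      exact (hno m' hm').not_gt (hlt.trans hm)
  have hvc : clockTime Γ v ≤ E.clock p τ :=
    ((clockTime_le_clockTime h.gamma_pos).2 (Nat.le_add_right v k)).trans hc
  obtain ⟨q, σ, hq, h0σ, hσ, hslow⟩ := h.exists_first_entry hp hτ hvc hno_later
  have hgst : E.gst ≤ σ := by
    by_contra! hlt
    exact (hfresh q hq).not_ge (hσ.symm.trans_le (h.clock_mono hq h0σ hlt.le))
  have hlong : σ + k * Γ ≤ τ := by
    linarith [hslow p hp τ hτ le_rfl hvc, clockTime_add Γ v k]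
  obtain ⟨m, hm, hlt⟩ := h.exists_qc_of_first_entry hv hl hq hgst hσ
    fun p hp s h0s hs => hslow p hp s h0s (hs.trans hlong)
  exact (hno m hm).not_gt (hlt.trans_le hlong)

/-- Messages can be reordered, so that a processor may be ahead of the view before its QC arrives;
the time is therefore taken to be the end of the broadcast. -/
theorem eventuallySynchronised (h : E.TimelyRun k Γ x δ B) : E.EventuallySynchronised k Γ := by
  obtain ⟨v, hv, hl, hfresh⟩ := h.exists_fresh_correct_lead h.k_pos
  obtain ⟨q, hq⟩ := h.exists_correct
  obtain ⟨τ, hτ, hc⟩ : ∃ τ, 0 ≤ τ ∧ clockTime Γ (v + k) ≤ E.clock q τ := by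
    have hτ : 0 ≤ clockTime Γ (v + k) - E.clock q 0 := by
      linarith [clockTime_nonneg h.gamma_pos (v + k), h.clocks.clock_zero_nonpos q hq]
    exact ⟨_, hτ, by linarith [h.clock_add_le hq le_rfl hτ]⟩
  obtain ⟨m, hm, -⟩ := h.exists_qc_of_clock hv hl hfresh hq hτ hc
  obtain ⟨r, -, hr⟩ := h.exists_produces hl hm
  have hgr : E.gst < r := by
    obtain ⟨m', -, hm', rfl⟩ := hr.1
    exact h.gst_lt_of_qc hfresh hm'
  refine ⟨v, r + δ, hl, by linarith [h.delta_pos], fun p hp => ?_, fun p hp s hs _ => ?_⟩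
  · cases hview : E.view p E.gst with
    | bot => exact WithBot.bot_lt_coe _
    | coe w =>
      have hlt :=
        (h.clockTime_le_clock_of_view hp h.network.gst_nonneg hview).trans_lt (hfresh p hp)
      rw [← not_le, clockTime_le_clockTime h.gamma_pos, not_le] at hlt
      exact WithBot.coe_lt_coe.2 hlt
  · exact Or.inr (h.hasQC_of_produces hl hr hp (by rwa [max_eq_right hgr.le]))

theorem firstQC_le_of_clock (h : E.TimelyRun k Γ x δ B) (hv : Initial k v)
    (hl : E.Correct (lead n k v)) (hfresh : E.Fresh Γ v) (hp : E.Correct p) (hτ : 0 ≤ τ)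
    (hc : clockTime Γ (v + k) ≤ E.clock p τ) : E.firstQC k ≤ (τ : EReal) := by
  obtain ⟨m, hm, hlt⟩ := h.exists_qc_of_clock hv hl hfresh hp hτ hc
  exact (h.firstQC_le_of_qc hfresh hl hm).trans (EReal.coe_le_coe_iff.2 hlt.le)

end TimelyRun

/-! ### Words and latency -/

namespace FeverRun

theorem encard_view_le (h : E.FeverRun k Γ δ) (v : ℕ) :
    {m | E.Correct (E.src m) ∧ E.content m = Content.view v}.encard ≤ n := by
  refine encard_le_of_injOn_fin (f := E.src) fun m hm m' hm' heq => ?_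
  obtain ⟨h0, -, hd, hc⟩ := (h.fever.view_message _ hm.1 (E.dst m) v (E.sent m)).1
    ⟨m, rfl, rfl, hm.2, rfl⟩
  obtain ⟨h0', -, hd', hc'⟩ := (h.fever.view_message _ hm'.1 (E.dst m') v (E.sent m')).1
    ⟨m', rfl, rfl, hm'.2, rfl⟩
  exact h.fever.once m m' v hm.1 (Or.inl hm.2) heq (hd.trans hd'.symm) (hm.2.trans hm'.2.symm)
    (h.clock_injOn hm.1 h0 h0' (hc.trans (heq ▸ hc'.symm)))

theorem encard_vc_le (h : E.FeverRun k Γ δ) (v : ℕ) :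
    {m | E.Correct (E.src m) ∧ E.content m = Content.vc v}.encard ≤ n := by
  refine encard_le_of_injOn_fin (f := E.dst) fun m hm m' hm' heq => ?_
  obtain ⟨-, hl, hleast⟩ := (h.fever.vc_message _ hm.1 (E.dst m) v (E.sent m)).1
    ⟨m, rfl, rfl, hm.2, rfl⟩
  obtain ⟨-, hl', hleast'⟩ := (h.fever.vc_message _ hm'.1 (E.dst m') v (E.sent m')).1
    ⟨m', rfl, rfl, hm'.2, rfl⟩
  have hsrc := hl.trans hl'.symm
  exact h.fever.once m m' v hm.1 (Or.inr hm.2) hsrc heq (hm.2.trans hm'.2.symm)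
    (hleast.unique (hsrc ▸ hleast'))

end FeverRun

namespace ProtocolRun

theorem encard_index_le (h : E.ProtocolRun k Γ x δ B) (w : ℕ) :
    {m | E.Correct (E.src m) ∧ (E.content m).index = w}.encard ≤ (((B + 2) * n : ℕ) : ℕ∞) := by
  have hsub : {m | E.Correct (E.src m) ∧ (E.content m).index = w} ⊆
      {m | E.Correct (E.src m) ∧ ∃ q, E.content m = Content.under w q} ∪
        ({m | E.Correct (E.src m) ∧ E.content m = Content.view w} ∪
          {m | E.Correct (E.src m) ∧ E.content m = Content.vc w}) := by
    rintro m ⟨hm, rfl⟩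
    cases hc : E.content m with
    | view v => exact Or.inr (Or.inl ⟨hm, hc⟩)
    | vc v => exact Or.inr (Or.inr ⟨hm, hc⟩)
    | under w q => exact Or.inl ⟨hm, q, hc⟩
  refine (Set.encard_le_encard hsub).trans ((Set.encard_union_le _ _).trans
    ((add_le_add (h.underlying.linear w) ((Set.encard_union_le _ _).trans
      (add_le_add (h.encard_view_le w) (h.encard_vc_le w)))).trans_eq ?_))
  push_cast
  ring

theorem view_eq_index_or_eq_vc (h : E.ProtocolRun k Γ x δ B) (hm : E.Correct (E.src m))
    (hgst : E.gst < E.sent m) (hquiet : (E.sent m : EReal) < E.firstQC k) :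
    E.view (E.src m) (E.sent m) = ((E.content m).index : WithBot ℕ) ∨
      E.content m = Content.vc (E.content m).index := by
  cases hc : E.content m with
  | view v =>
    obtain ⟨h0, hv, -, hclock⟩ := (h.fever.view_message _ hm (E.dst m) v (E.sent m)).1
      ⟨m, rfl, rfl, hc, rfl⟩
    exact Or.inl (h.fever.view_initial _ hm v hv _ h0 hclock)
  | vc v => exact Or.inr rfl
  | under w q =>
    refine Or.inl ((h.underlying.in_view m w q hm hc).resolve_right ?_)
    rintro ⟨-, hsrc, hr⟩
    exact (firstQC_le hr (hsrc ▸ hm) hgst).not_gt hquiet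

theorem quorumReaches_gst (h : E.ProtocolRun k Γ x δ B) (hk : 0 < k) {j : ℕ}
    (hj : ¬ E.Fresh Γ (k * (j + 1))) : E.QuorumReaches Γ (k * j) E.gst := by
  rw [Fresh] at hj
  push Not at hj
  obtain ⟨p, hp, hc⟩ := hj
  refine h.quorumReaches_of_clock (initial_mul k j) hp h.network.gst_nonneg
    (((clockTime_le_clockTime h.gamma_pos).2 ?_).trans hc)
  rw [Nat.mul_succ]
  exact Nat.add_le_add_left hk _

theorem le_view_of_not_fresh (h : E.ProtocolRun k Γ x δ B) (hk : 0 < k) {i : ℕ}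
    (hi : ¬ E.Fresh Γ (k * (i + E.byz.card + 1))) (hp : E.Correct p)
    (hτ : E.gst + 2 * δ ≤ τ) : ((k * i : ℕ) : WithBot ℕ) ≤ E.view p τ := by
  obtain ⟨j, hij, hji, hl⟩ := h.exists_correct_lead hk i
  have hj : ¬ E.Fresh Γ (k * (j + 1)) := fun hj =>
    hi (hj.mono h.gamma_pos (Nat.mul_le_mul_left k (by omega)))
  have hc : clockTime Γ (k * j) ≤ E.clock p τ :=
    h.clockTime_le_clock_of_quorumReaches (initial_mul k j) hl (h.quorumReaches_gst hk hj) hp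
      (by rwa [max_self])
  have h0τ : 0 ≤ τ := by linarith [h.network.gst_nonneg, h.delta_pos]
  exact (WithBot.coe_le_coe.2 (Nat.mul_le_mul_left k hij)).trans
    (h.le_view_of_clockTime_le (initial_mul k j) hp h0τ hc)

theorem le_index_of_not_fresh (h : E.ProtocolRun k Γ x δ B) (hk : 0 < k) {i : ℕ}
    (hi : ¬ E.Fresh Γ (k * (i + E.byz.card + 1))) (hm : E.Correct (E.src m))
    (hsent : E.gst + 2 * δ < E.sent m) (hquiet : (E.sent m : EReal) < E.firstQC k) :
    k * i ≤ (E.content m).index := by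
  have hδ := h.delta_pos
  rcases h.view_eq_index_or_eq_vc hm (by linarith) hquiet with hview | hvc
  · exact WithBot.coe_le_coe.1 ((h.le_view_of_not_fresh hk hi hm hsent.le).trans_eq hview)
  obtain ⟨hv, hl, hleast⟩ :=
    (h.fever.vc_message _ hm (E.dst m) (E.content m).index (E.sent m)).1 ⟨m, rfl, rfl, hvc, rfl⟩
  obtain ⟨j, hj⟩ := Nat.dvd_of_mod_eq_zero hv
  rw [hj] at hv hl hleast ⊢
  by_contra! hlt
  have hji : j + 1 ≤ i + E.byz.card + 1 := by
    have := Nat.lt_of_mul_lt_mul_left hlt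
    omega
  have hquorum := h.quorumReaches_gst hk fun hfresh =>
    hi (hfresh.mono h.gamma_pos (Nat.mul_le_mul_left k hji))
  obtain ⟨σ, hσ, hleast'⟩ := h.exists_vc_time hv (hl ▸ hm) hquorum
  rw [max_self] at hσ
  linarith [hleast.unique (hl ▸ hleast')]

theorem exists_clockTime_index_le (h : E.ProtocolRun k Γ x δ B) (hm : E.Correct (E.src m))
    (hgst : E.gst < E.sent m) (hquiet : (E.sent m : EReal) < E.firstQC k) :
    ∃ q, E.Correct q ∧ clockTime Γ (E.content m).index ≤ E.clock q (E.sent m) := by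
  rcases h.view_eq_index_or_eq_vc hm hgst hquiet with hview | hvc
  · exact ⟨_, hm, h.clockTime_le_clock_of_view hm (h.network.sent_nonneg m) hview⟩
  · obtain ⟨-, q, m', hq, hle, hclock⟩ := h.exists_clock_eq_of_vc hvc
    exact ⟨q, hq, hclock.symm.trans_le (h.clock_mono hq (h.network.sent_nonneg m') hle)⟩

end ProtocolRun

namespace TimelyRun

theorem firstQC_le_of_fresh (h : E.TimelyRun k Γ x δ B) {b : ℕ} (hb : E.Fresh Γ (k * b))
    (hp : E.Correct p) (hτ : 0 ≤ τ) (hc : clockTime Γ (k * (b + E.byz.card + 1)) ≤ E.clock p τ) :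
    E.firstQC k ≤ (τ : EReal) := by
  obtain ⟨j, hbj, hjb, hl⟩ := h.exists_correct_lead h.k_pos b
  refine h.firstQC_le_of_clock (initial_mul k j) hl
    (hb.mono h.gamma_pos (Nat.mul_le_mul_left k hbj)) hp hτ (le_trans ?_ hc)
  rw [clockTime_le_clockTime h.gamma_pos, ← Nat.mul_succ]
  exact Nat.mul_le_mul_left k (Nat.succ_le_succ hjb)

theorem wordsFrom_le (h : E.TimelyRun k Γ x δ B) :
    E.wordsFrom k (E.gst + 2 * δ) ≤ ((3 * k * (B + 2) * (E.byz.card * n + n) : ℕ) : ℕ∞) := by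
  obtain ⟨b, hfresh, hleast⟩ := h.exists_isLeast_fresh h.k_pos
  set f := E.byz.card
  have hsub : {m | E.Correct (E.src m) ∧ E.gst + 2 * δ < E.sent m ∧
      (E.sent m : EReal) < E.firstQC k} ⊆
      ⋃ w ∈ Finset.Ico (k * (b - 2 - f)) (k * (b + f + 1)),
        {m | E.Correct (E.src m) ∧ (E.content m).index = w} := by
    rintro m ⟨hm, hsent, hquiet⟩
    refine Set.mem_biUnion (Finset.mem_coe.2 (Finset.mem_Ico.2 ⟨?_, ?_⟩)) ⟨hm, rfl⟩
    · rcases lt_or_ge b (f + 2) with hlt | hge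
      · rw [show b - 2 - f = 0 by omega, Nat.mul_zero]
        exact Nat.zero_le _
      · refine h.le_index_of_not_fresh h.k_pos (fun hfr => ?_) hm hsent hquiet
        have := hleast hfr
        omega
    · obtain ⟨q, hq, hc⟩ := h.exists_clockTime_index_le hm (by linarith [h.delta_pos]) hquiet
      by_contra! hle
      exact (h.firstQC_le_of_fresh hfresh hq (h.network.sent_nonneg m)
        (((clockTime_le_clockTime h.gamma_pos).2 hle).trans hc)).not_gt hquiet
  have hcard : (Finset.Ico (k * (b - 2 - f)) (k * (b + f + 1))).card ≤ k * (3 * (f + 1)) := by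
    rw [Nat.card_Ico, ← Nat.mul_sub]
    exact Nat.mul_le_mul_left k (by omega)
  refine (Set.encard_le_encard hsub).trans ((Finset.set_encard_biUnion_le _ _).trans
    ((Finset.sum_le_card_nsmul _ _ _ fun w _ => h.encard_index_le w).trans ?_))
  rw [nsmul_eq_mul]
  norm_cast
  calc _ ≤ k * (3 * (f + 1)) * ((B + 2) * n) := Nat.mul_le_mul_right _ hcard
    _ = 3 * k * (B + 2) * (f * n + n) := by ring

theorem latency_le_of_begun (h : E.TimelyRun k Γ x δ B) (hp : E.Correct p)
    (hc : 0 ≤ E.clock p E.gst) : E.latency k ≤ ((k * (E.byz.card + 2) * Γ : ℝ) : EReal) := by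
  have hΓ := h.gamma_pos
  have hg := h.network.gst_nonneg
  obtain ⟨b, hfresh, hleast⟩ := h.exists_isLeast_fresh h.k_pos
  obtain ⟨q, hq, hcq⟩ : ∃ q, E.Correct q ∧ clockTime Γ (k * (b - 1)) ≤ E.clock q E.gst := by
    rcases Nat.eq_zero_or_pos b with rfl | hb
    · exact ⟨p, hp, by rwa [Nat.zero_sub, Nat.mul_zero, clockTime_zero]⟩
    · have hnot : ¬ E.Fresh Γ (k * (b - 1)) := fun hfr => by
        have := hleast hfr
        omega
      simpa only [Fresh, not_forall, exists_prop, not_lt] using hnot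
  have hd : 0 ≤ k * (E.byz.card + 2) * Γ := by positivity
  refine latency_le_of_firstQC_le (h.firstQC_le_of_fresh hfresh hq (by linarith) ?_)
  have hrun := h.clock_add_le hq hg (le_add_of_nonneg_right hd)
  calc clockTime Γ (k * (b + E.byz.card + 1))
      ≤ clockTime Γ (k * (b - 1) + k * (E.byz.card + 2)) := by
        rw [clockTime_le_clockTime hΓ, ← Nat.mul_add]
        exact Nat.mul_le_mul_left k (by omega)
    _ ≤ _ := by
        rw [clockTime_add]
        push_cast
        linarith

end TimelyRun

/-! ### Latency without Byzantine processors -/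

namespace ProtocolRun

theorem hasQC_of_le_view (h : E.ProtocolRun k Γ x δ B) (hv : Initial k v)
    (hl : E.Correct (lead n k v)) (hvw : v ≤ w) (hwk : w < v + k) {a : ℝ} (ha : E.gst + δ ≤ a)
    (hquiet : ((a + x * δ : ℝ) : EReal) < E.firstQC k) {S : Finset (Fin n)}
    (hS : n - resilience n ≤ S.card) (hSc : ∀ p ∈ S, E.Correct p)
    (hview : ∀ p ∈ S, (w : WithBot ℕ) ≤ E.view p a)
    (hstay : ∀ p ∈ S, ∀ s, a ≤ s → s < a + x * δ → E.clock p s < clockTime Γ (v + k))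
    (hp : E.Correct p) : E.HasQC p w a := by
  have hga : E.gst ≤ a := by linarith [h.delta_pos]
  obtain ⟨m, hm, hms⟩ := h.exists_qc_of_le_view hv hl hvw hwk hga hS hSc fun q hq s has hs =>
    ⟨(hview q hq).trans (h.viewMonotone q (hSc q hq) a s (h.network.gst_nonneg.trans hga) has),
      hstay q hq s has hs⟩
  rw [← lead_eq_of_initial hv hvw hwk] at hl
  obtain ⟨r, hr, hprod⟩ :=
    h.exists_produces_le_gst hl hm ((EReal.coe_lt_coe_iff.2 hms).trans hquiet)
  exact h.hasQC_of_produces hl hprod hp (by rwa [max_eq_left hr])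

theorem exists_leaves_block (h : E.ProtocolRun k Γ x δ B) (hx : 0 < x) (hk : 0 < k)
    (hv : Initial k v) (hl : E.Correct (lead n k v)) {a : ℝ} (ha : E.gst + δ ≤ a)
    (hquiet : ((a + x * δ : ℝ) : EReal) < E.firstQC k) {S : Finset (Fin n)}
    (hS : n - resilience n ≤ S.card) (hSc : ∀ p ∈ S, E.Correct p)
    (hcv : ∀ p ∈ S, clockTime Γ v ≤ E.clock p a) :
    ∃ p ∈ S, ∃ s, a ≤ s ∧ s < a + x * δ ∧ clockTime Γ (v + k) ≤ E.clock p s := by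
  by_contra! hstay
  have h0a : 0 ≤ a := by linarith [h.network.gst_nonneg, h.delta_pos]
  have hview : ∀ i < k, ∀ p ∈ S, ((v + i : ℕ) : WithBot ℕ) ≤ E.view p a := by
    intro i hi p hp
    induction i generalizing p with
    | zero => exact h.le_view_of_clockTime_le hv (hSc p hp) h0a (hcv p hp)
    | succ i ih =>
      have hqc := h.hasQC_of_le_view hv hl (Nat.le_add_right v i) (by omega) ha hquiet hS hSc
        (ih (by omega)) hstay (hSc p hp)
      exact h.le_view_of_triggered (hSc p hp) h0a
        (Or.inr ⟨not_initial_of_lt hv (by omega) (by omega), v + i, rfl, hqc⟩)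
  obtain ⟨p, hp⟩ : S.Nonempty := Finset.card_pos.1 (by have := three_mul_resilience_lt n; omega)
  obtain ⟨i, rfl⟩ := Nat.exists_eq_succ_of_ne_zero hk.ne'
  obtain ⟨s, hsa, hqc⟩ := h.hasQC_of_le_view hv hl (Nat.le_add_right v i) (by omega) ha hquiet
    hS hSc (hview i (by omega)) hstay (hSc p hp)
  exact (hstay p hp a le_rfl (by linarith [mul_pos hx h.delta_pos])).not_ge
    (h.clockTime_le_clock_of_recvCert (hSc p hp) hqc.recvCert hsa)

/-- Otherwise `n - t` processors have not reached view `k * (j + 1)` by themselves; they are in the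
block of view `k * j` from `τ + 2 * δ` on, and one of them leaves it. -/
theorem quorumReaches_succ (h : E.ProtocolRun k Γ x δ B) (hx : 0 < x) (hk : 0 < k)
    (hall : ∀ p, E.Correct p) {j : ℕ} (hτ : E.gst ≤ τ)
    (hquiet : ((τ + (2 + x) * δ : ℝ) : EReal) < E.firstQC k)
    (hj : E.QuorumReaches Γ (k * j) τ) :
    E.QuorumReaches Γ (k * (j + 1)) (τ + (2 + x) * δ) := by
  by_contra hno
  have hδ := h.delta_pos
  rw [show τ + (2 + x) * δ = τ + 2 * δ + x * δ by ring] at hno hquiet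
  set T := τ + 2 * δ + x * δ
  obtain ⟨S, hS, hnot⟩ := CorrectQuorum.exists_finset_of_not hall hno
  obtain ⟨p, hp, s, has, hsT, hc⟩ := h.exists_leaves_block hx hk (initial_mul k j) (hall _)
    (a := τ + 2 * δ) (by linarith) hquiet hS (fun p _ => hall p) fun p _ =>
      h.clockTime_le_clock_of_quorumReaches (initial_mul k j) (hall _) hj (hall p)
        (by rw [max_eq_right hτ])
  rw [← Nat.mul_succ] at hc
  have h0s : 0 ≤ s := by linarith [h.network.gst_nonneg]
  rcases h.reaches_or_quorumReaches (initial_mul k (j + 1)) (hall p) h0s hc with hr | hqr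
  · exact hnot p hp (hr.mono hsT.le)
  · exact hno (hqr.mono hsT.le)

theorem quorumReaches_add (h : E.ProtocolRun k Γ x δ B) (hx : 0 < x) (hk : 0 < k)
    (hall : ∀ p, E.Correct p) {j : ℕ} (hτ : E.gst ≤ τ) (hj : E.QuorumReaches Γ (k * j) τ) (i : ℕ)
    (hquiet : ((τ + i * ((2 + x) * δ) : ℝ) : EReal) < E.firstQC k) :
    E.QuorumReaches Γ (k * (j + i)) (τ + i * ((2 + x) * δ)) := by
  have hd : 0 < (2 + x) * δ := mul_pos (by linarith) h.delta_pos
  induction i with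
  | zero => rwa [Nat.cast_zero, zero_mul, add_zero, add_zero]
  | succ i ih =>
    rw [show τ + ((i + 1 : ℕ) : ℝ) * ((2 + x) * δ) = τ + i * ((2 + x) * δ) + (2 + x) * δ by
      push_cast; ring] at hquiet ⊢
    exact h.quorumReaches_succ hx hk hall (hτ.trans (le_add_of_nonneg_right (by positivity)))
      hquiet (ih ((EReal.coe_lt_coe_iff.2 (by linarith)).trans hquiet))

theorem quorumReaches_zero_of_begun (h : E.ProtocolRun k Γ x δ B)
    (hbegun : resilience n + 1 ≤ E.begunByGST) : E.QuorumReaches Γ 0 E.gst :=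
  CorrectQuorum.of_forall_or (P := fun q => 0 ≤ E.clock q E.gst) hbegun fun _ hq hc =>
    h.reaches_or_quorumReaches (Nat.zero_mod k) hq h.network.gst_nonneg
      ((clockTime_zero Γ).trans_le hc)

theorem exists_last_quorumReaches_gst (h : E.ProtocolRun k Γ x δ B) (hk : 0 < k)
    (hzero : E.QuorumReaches Γ 0 E.gst) :
    ∃ j, E.QuorumReaches Γ (k * j) E.gst ∧ ¬ E.QuorumReaches Γ (k * (j + 1)) E.gst := by
  by_contra! hsucc
  obtain ⟨b, hb, -⟩ := h.exists_isLeast_fresh hk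
  have hevery : ∀ j, E.QuorumReaches Γ (k * j) E.gst := fun j => by
    induction j with
    | zero => exact hzero
    | succ j ih => exact hsucc j ih
  obtain ⟨q, hq, hr⟩ := (hevery b).exists_correct
  exact (hb q hq).not_ge (h.clockTime_le_clock_of_reaches hq hr)

end ProtocolRun

namespace TimelyRun

theorem latency_le_of_forall_correct (h : E.TimelyRun k Γ x δ B) (hall : ∀ p, E.Correct p)
    (hbegun : resilience n + 1 ≤ E.begunByGST) :
    E.latency k ≤ (((k + 1) * ((2 + x) * δ) : ℝ) : EReal) := by
  have hΓ := h.gamma_pos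
  have hg := h.network.gst_nonneg
  refine latency_le_of_firstQC_le (le_of_not_gt fun hquiet => ?_)
  obtain ⟨j, hj, hj'⟩ :=
    h.exists_last_quorumReaches_gst h.k_pos (h.quorumReaches_zero_of_begun hbegun)
  have hv := initial_mul k (j + 1)
  obtain ⟨q, hq, τ, h0τ, hτ, hcτ⟩ := (h.quorumReaches_add h.x_pos h.k_pos hall le_rfl hj (k + 1)
    (by rwa [Nat.cast_succ])).exists_correct
  rw [Nat.cast_succ] at hτ
  rw [← Nat.add_assoc, Nat.add_right_comm, Nat.mul_add] at hcτ
  obtain ⟨q₀, s₀, hq₀, h0s₀, hs₀, hle⟩ := h.exists_clock_eq_of_no_qc hq h0τ (v := k * (j + 1))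
    (by rw [hcτ, clockTime_le_clockTime hΓ]; exact Nat.le_add_right _ _) fun m u hm hvu hqc => by
      obtain ⟨r, hr, hprod⟩ := h.exists_produces_le_gst (hall _) hqc
        ((EReal.coe_lt_coe_iff.2 (hm.trans_le hτ)).trans hquiet)
      obtain ⟨m', -, hqc', rfl⟩ := hprod.1
      exact hj' ((h.quorumReaches_of_qc hv hvu hqc').mono hr)
  have hearly : s₀ + Γ ≤ E.gst := by
    rw [hcτ, clockTime_add] at hle
    push_cast at hle
    have hδk : (k + 1) * ((2 + x) * δ) ≤ (k + 1) * (k * Γ - Γ) := by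
      gcongr
      linarith [h.block_length]
    linarith
  refine hj' (h.quorumReaches_of_clock hv hq₀ hg ?_)
  linarith [h.clock_add_le hq₀ h0s₀ (by linarith : s₀ ≤ E.gst), clockTime_succ Γ (k * (j + 1))]

end TimelyRun

end Fever

theorem IsFeverExecution.timelyRun [NeZero n] (h : E.IsFeverExecution k x B Δ δ) (hx : 0 < x)
    (hkx : 2 ≤ ((k : ℝ) - 2) * x) : E.TimelyRun k (x * Δ) x δ B where
  gamma_pos := mul_pos hx (h.delta_pos.trans_le h.delta_le)
  delta_pos := h.delta_pos
  byz_card := h.byz_card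
  network := h.network
  clocks := h.clocks
  fever := h.fever
  underlying := h.underlying
  x_pos := hx
  block_length := by
    have hΔ : 0 < Δ := h.delta_pos.trans_le h.delta_le
    calc x * Δ + (2 + x) * δ ≤ x * Δ + (2 + x) * Δ := by gcongr; exact h.delta_le
      _ ≤ x * Δ + ((k - 2) * x + x) * Δ := by gcongr
      _ = k * (x * Δ) := by ring

theorem TimelyRun.latency_le [NeZero n] (h : E.TimelyRun k (x * Δ) x δ B) (hΔ : 0 ≤ Δ) {C : ℝ}
    (hC₀ : (k + 1) * (2 + x) ≤ C) (hC₁ : 3 * k * x ≤ C) (hpos : 0 < E.begunByGST)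
    (hbegun : E.byz.card = 0 → resilience n + 1 ≤ E.begunByGST) :
    E.latency k ≤ ((C * (Δ * E.byz.card + δ) : ℝ) : EReal) := by
  have hδ := h.delta_pos
  have hx := h.x_pos
  have hC : 0 ≤ C := le_trans (by positivity) hC₁
  rcases Nat.eq_zero_or_pos E.byz.card with hf | hf
  · have hall : ∀ p, E.Correct p := fun p => by
      rw [Correct, Finset.card_eq_zero.1 hf]
      exact Finset.notMem_empty p
    refine (h.latency_le_of_forall_correct hall (hbegun hf)).trans (EReal.coe_le_coe_iff.2 ?_)
    calc (k + 1) * ((2 + x) * δ) = (k + 1) * (2 + x) * δ := by ring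
      _ ≤ C * (Δ * E.byz.card + δ) := by
        gcongr
        exact le_add_of_nonneg_left (by positivity)
  · obtain ⟨p, hp, hc⟩ := Set.nonempty_of_ncard_ne_zero hpos.ne'
    refine (h.latency_le_of_begun hp hc).trans (EReal.coe_le_coe_iff.2 ?_)
    have hf : (1 : ℝ) ≤ E.byz.card := by exact_mod_cast hf
    calc k * (E.byz.card + 2) * (x * Δ) ≤ k * (E.byz.card + 2 * E.byz.card) * (x * Δ) := by
          gcongr
          linarith
      _ = 3 * k * x * (Δ * E.byz.card) := by ring
      _ ≤ C * (Δ * E.byz.card + δ) := by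
        gcongr
        exact le_add_of_nonneg_right hδ.le

end Execution

end Fever

theorem theorem1_general (k : ℕ) (x : ℝ) (hx : 0 < x) (hkx : 2 ≤ ((k : ℝ) - 2) * x) (B : ℕ) :
    ∃ C : ℕ, ∀ (n : ℕ) [NeZero n] (Δ δ : ℝ) (E : Fever.Execution n),
      E.IsFeverExecution k x B Δ δ →
        E.ViewMonotone ∧
        E.EventuallySynchronised k (x * Δ) ∧
        E.wordsFrom k (E.gst + 2 * δ) ≤ ((C * (E.byz.card * n + n) : ℕ) : ℕ∞) ∧
        (0 < E.begunByGST →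
          (E.byz.card = 0 → Fever.resilience n + 1 ≤ E.begunByGST) →
          E.latency k ≤ ((C * (Δ * E.byz.card + δ) : ℝ) : EReal)) := by
  obtain ⟨C, hC⟩ := exists_nat_ge
    (max ((3 * k * (B + 2) : ℕ) : ℝ) (max ((k + 1) * (2 + x)) (3 * k * x)))
  obtain ⟨hC_words, hC₀, hC₁⟩ : 3 * k * (B + 2) ≤ C ∧ (k + 1) * (2 + x) ≤ C ∧ 3 * k * x ≤ C := by
    simpa only [max_le_iff, Nat.cast_le] using hC
  refine ⟨C, fun n _ Δ δ E hE => ?_⟩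
  have h := hE.timelyRun hx hkx
  refine ⟨h.viewMonotone, h.eventuallySynchronised, h.wordsFrom_le.trans ?_,
    h.latency_le (hE.delta_pos.le.trans hE.delta_le) hC₀ hC₁⟩
  exact_mod_cast Nat.mul_le_mul_right _ hC_words

theorem theorem1 (k : ℕ) (hk : 3 ≤ k) (x : ℝ) (hx : 2 ≤ x) (B : ℕ) :
    ∃ C : ℕ, ∀ (n : ℕ) [NeZero n] (Δ δ : ℝ) (E : Fever.Execution n),
      E.IsFeverExecution k x B Δ δ →
        E.ViewMonotone ∧
        E.EventuallySynchronised k (x * Δ) ∧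
        E.wordsFrom k (E.gst + 2 * δ) ≤ ((C * (E.byz.card * n + n) : ℕ) : ℕ∞) ∧
        (0 < E.begunByGST →
          (E.byz.card = 0 → Fever.resilience n + 1 ≤ E.begunByGST) →
          E.latency k ≤ ((C * (Δ * E.byz.card + δ) : ℝ) : EReal)) := by
  have hk : (3 : ℝ) ≤ k := by exact_mod_cast hk
  exact theorem1_general k x (by linarith) (by nlinarith) B
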